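/- Let $d$ be a dimension and $1<p\le\infty$. There exist constants $c,C>0$, depending only on $p$ and $d$, such that the following holds. Let $T>0$, let $u:[0,T]\times\mathbb{R}^d\to\mathbb{R}^d$ be a smooth velocity field that is periodic in space with period cell $[0,1)^d$ and satisfies $\nabla\cdot u=0$, let $\rho_0:\mathbb{R}^d\to\{\pm1\}$ be measurable and $[0,1)^d$-periodic with $\int_{[0,1)^d}\rho_0\,dx=0$, and let $\rho:[0,T]\times\mathbb{R}^d\to\{\pm1\}$ be measurable, $[0,1)^d$-periodic in space, and a weak solution of $\partial_t\rho+u\cdot\nabla\rho=0$ with $\rho(0,\cdot)=\rho_0$, that is, $$\int_{[0,1)^d}\rho(t,x)\zeta(x)\,dx=\int_{[0,1)^d}\rho_0(x)\zeta(x)\,dx+\int_0^t\int_{[0,1)^d}\rho(s,x)\,u(s,x)\cdot\nabla\zeta(x)\,dx\,ds$$ for every $t\in[0,T]$ and every smooth periodic $\zeta:\mathbb{R}^d\to\mathbb{R}$. Then $$[\rho_0]_{BV}\,\|\rho(T,\cdot)\|_{\dot H^{-1}}\;\ge\; C\exp\left(-c\int_0^T\|\nabla u(t,\cdot)\|_{L^p([0,1)^d)}\,dt\right).$$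 Here $[f]_{BV}=\sup\{\int_{[0,1)^d} f\,\nabla\cdot\varphi\,dx:\varphi:\mathbb{R}^d\to\mathbb{R}^d \text{ smooth and periodic},\ |\varphi|\le1\}\in[0,\infty]$ and $\|f\|_{\dot H^{-1}}=\sup\{\int_{[0,1)^d} f\zeta\,dx:\zeta:\mathbb{R}^d\to\mathbb{R}\text{ smooth and periodic},\ \|\nabla\zeta\|_{L^2([0,1)^d)}\le1\}$, and $|\nabla u|$ is the operator norm of the Jacobian matrix. -/

import Mathlib

open MeasureTheory Set
open scoped ENNReal

noncomputable section

namespace Mixing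

/-- `ℝ^d` with the Euclidean norm. Functions on the torus `ℝ^d / ℤ^d` are represented by
periodic functions on this space. -/
abbrev E (d : ℕ) : Type := EuclideanSpace ℝ (Fin d)

/-- The period cell `[0,1)^d`. -/
def cell (d : ℕ) : Set (E d) := {x | ∀ i, x i ∈ Ico (0 : ℝ) 1}

/-- Lebesgue measure on the period cell. -/
def cellMeasure (d : ℕ) : Measure (E d) := volume.restrict (cell d)

/-- `f` is `ℤ^d`-periodic: it has period one in every coordinate direction. -/
def IsPeriodic {d : ℕ} {α : Type*} (f : E d → α) : Prop :=
  ∀ (i : Fin d) (x : E d), f (x + EuclideanSpace.single i 1) = f x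

/-- The divergence `∑ i, ∂ᵢ vᵢ` of a vector field. -/
def divergence {d : ℕ} (v : E d → E d) (x : E d) : ℝ :=
  ∑ i, (fderiv ℝ v x (EuclideanSpace.single i 1)) i

/-- The `L^p` norm over the period cell of the derivative of `f`. -/
def gradNorm {d : ℕ} {F : Type*} [NormedAddCommGroup F] [NormedSpace ℝ F]
    (p : ℝ≥0∞) (f : E d → F) : ℝ≥0∞ :=
  eLpNorm (fderiv ℝ f) p (cellMeasure d)

/-- The total variation on the torus: the supremum of `∫ f div φ` over all smooth periodic
vector fields `φ` with `|φ| ≤ 1`. -/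
def bvSeminorm {d : ℕ} (f : E d → ℝ) : ℝ≥0∞ :=
  ⨆ (φ : E d → E d) (_ : ContDiff ℝ (⊤ : ℕ∞) φ) (_ : IsPeriodic φ) (_ : ∀ x, ‖φ x‖ ≤ 1),
    ENNReal.ofReal (∫ x, f x * divergence φ x ∂(cellMeasure d))

/-- The homogeneous `H^{-1}` norm on the torus: the supremum of `∫ f ζ` over all smooth periodic
functions `ζ` with `‖∇ζ‖_{L²} ≤ 1`. -/
def hMinusOneNorm {d : ℕ} (f : E d → ℝ) : ℝ≥0∞ :=
  ⨆ (ζ : E d → ℝ) (_ : ContDiff ℝ (⊤ : ℕ∞) ζ) (_ : IsPeriodic ζ) (_ : gradNorm 2 ζ ≤ 1),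
    ENNReal.ofReal (∫ x, f x * ζ x ∂(cellMeasure d))

/-- `u` is a smooth, spatially periodic, divergence-free velocity field on `[0,T] × ℝ^d`. -/
structure IsIncompressibleFlow {d : ℕ} (T : ℝ) (u : ℝ → E d → E d) : Prop where
  smooth : ContDiffOn ℝ (⊤ : ℕ∞) (fun z : ℝ × E d => u z.1 z.2) (Icc 0 T ×ˢ univ)
  periodic : ∀ t ∈ Icc 0 T, IsPeriodic (u t)
  div_free : ∀ t ∈ Icc 0 T, ∀ x, divergence (u t) x = 0

/-- A measurable periodic function with values `±1` and mean zero. -/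
structure IsCriticalMixture {d : ℕ} (ρ₀ : E d → ℝ) : Prop where
  measurable : Measurable ρ₀
  periodic : IsPeriodic ρ₀
  values : ∀ x, ρ₀ x = 1 ∨ ρ₀ x = -1
  mean_zero : ∫ x, ρ₀ x ∂(cellMeasure d) = 0

/-- `ρ` is an indicator function with values `±1` that solves `∂ₜρ + u·∇ρ = 0`, `ρ(0) = ρ₀` on
`[0,T]` in the weak sense, for a divergence-free `u`. Testing at every time `t` fixes `ρ(t)`
almost everywhere for every `t`. -/
structure IsTransportSolution {d : ℕ} (T : ℝ) (u : ℝ → E d → E d) (ρ₀ : E d → ℝ)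
    (ρ : ℝ → E d → ℝ) : Prop where
  measurable : Measurable (fun z : ℝ × E d => ρ z.1 z.2)
  periodic : ∀ t ∈ Icc 0 T, IsPeriodic (ρ t)
  values : ∀ t ∈ Icc 0 T, ∀ x, ρ t x = 1 ∨ ρ t x = -1
  weak : ∀ ζ : E d → ℝ, ContDiff ℝ (⊤ : ℕ∞) ζ → IsPeriodic ζ → ∀ t ∈ Icc 0 T,
    ∫ x, ρ t x * ζ x ∂(cellMeasure d) =
      ∫ x, ρ₀ x * ζ x ∂(cellMeasure d) +
        ∫ s in (0 : ℝ)..t, ∫ x, ρ s x * fderiv ℝ ζ x (u s x) ∂(cellMeasure d)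

end Mixing

end

/-! The proof is the Crippa–De Lellis argument in dual form, with an explicit Euler scheme in place
of the flow map.

Let B be the total variation of ρ₀. Mollifying a smooth approximation of ρ₀ at scale 1/(8B) gives a
function ζ with |ζ| ≤ 1, Lipschitz constant of order B and ∫ρ₀ζ ≥ 3/4, because a translation by z
changes a pairing with ρ₀ by at most B‖z‖ (`IsKernel.integral_mul_sub_le_mollify`). If ζ can be
transported to time T so that it remains Lipschitz with some constant L and correlated with `ρ T`,
then dividing it by L gives an admissible test function, and the negative norm is at least of order
1/L. So L must be bounded by B times an exponential of the integrated gradient norm.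

For p > 1 the maximal function of ∇v yields ‖v x - v y‖ ≤ ‖x - y‖ (m x + m y), where the mean of m
is at most C‖∇v‖_p (`exists_lusin_lipschitz`). Summing these m along the discrete trajectories gives
g with ‖x - y‖ ≤ exp (g x + g y) ‖Ψ x - Ψ y‖ (`norm_sub_le_eulerFlow`). An Euler step for a
divergence-free field has Jacobian 1 - o(h), so the scheme almost preserves measure
(`IsIncompressibleFlow.exists_lintegral_eulerFlow_le`), and ∫g is bounded by the time integral of
the gradient norm plus one. On {g ≤ λ} the function ζ ∘ Ψ⁻¹ is Lipschitz with a constant multiplied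
by exp (2λ); it is extended by McShane's formula (`exists_periodic_extension`). By Chebyshev the
complement is negligible once λ is a large multiple of the bound for ∫g.

The weak solution is linked to the scheme by testing the equation with pulled-back functions: ∫ρ(T)θ
and ∫ρ₀ θ∘Ψ differ by O(h) (`IsTransportSolution.abs_eulerFlow_le`). Neither a flow map nor
uniqueness of weak solutions is needed. Higher bounds on u enter only in errors that are made small
by the choice of h, so they are absent from the final constants. The correlation decreases from 1 to
3/4 (approximation and mollification of ρ₀), to 1/2 (bad set and mollification of the extension) and
to 1/4 (Euler error). -/

open scoped Pointwise

noncomputable section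

namespace Mixing

variable {d : ℕ}

/-! ### Periodic functions and integration over the period cell -/

/-- The standard basis of `ℝ^d`. -/
def stdBasis (d : ℕ) : Module.Basis (Fin d) ℝ (E d) := (EuclideanSpace.basisFun (Fin d) ℝ).toBasis

/-- The lattice `ℤ^d`. -/
abbrev lattice (d : ℕ) : Submodule ℤ (E d) := Submodule.span ℤ (range (stdBasis d))

lemma stdBasis_apply (i : Fin d) : stdBasis d i = EuclideanSpace.single i 1 := by
  simp [stdBasis]

lemma cell_eq : cell d = ZSpan.fundamentalDomain (stdBasis d) := by
  ext x
  simp [cell, ZSpan.mem_fundamentalDomain, stdBasis]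

lemma measurableSet_cell : MeasurableSet (cell d) := by
  rw [cell_eq]; exact ZSpan.fundamentalDomain_measurableSet _

instance : VAddInvariantMeasure (lattice d) (E d) volume :=
  ⟨fun v s _ => measure_preimage_add volume (v : E d) s⟩

instance : MeasurableConstVAdd (lattice d) (E d) :=
  ⟨fun v => measurable_const_add (v : E d)⟩

lemma isAddFundamentalDomain_cell : IsAddFundamentalDomain (lattice d) (cell d) volume := by
  rw [cell_eq]; exact ZSpan.isAddFundamentalDomain _ _

lemma volume_cell : volume (cell d) = 1 := by
  have h := (EuclideanSpace.volume_preserving_symm_measurableEquiv_toLp (Fin d)).measure_preimage_equiv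
    (univ.pi fun _ => Ico (0 : ℝ) 1)
  rw [Real.volume_pi_Ico] at h
  simp only [sub_zero, ENNReal.ofReal_one, Finset.prod_const_one] at h
  rw [← h]
  congr 1
  ext x
  simp [cell]

instance : IsProbabilityMeasure (cellMeasure d) := ⟨by simp [cellMeasure, volume_cell]⟩

lemma IsPeriodic.add_lattice {α : Type*} {f : E d → α} (hf : IsPeriodic f) {v : E d}
    (hv : v ∈ lattice d) (x : E d) : f (x + v) = f x := by
  induction hv using Submodule.span_induction generalizing x with
  | mem v hv =>
    obtain ⟨i, rfl⟩ := hv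
    rw [stdBasis_apply]; exact hf i x
  | zero => simp
  | add v w _ _ h1 h2 => rw [← add_assoc, h2, h1]
  | smul a v _ h =>
    have key : ∀ (n : ℕ) (x : E d), f (x + (n : ℤ) • v) = f x := by
      intro n
      induction n with
      | zero => simp
      | succ n ih => intro x; push_cast; rw [add_smul, one_smul, ← add_assoc, h]; exact_mod_cast ih x
    rcases Int.eq_nat_or_neg a with ⟨n, rfl | rfl⟩
    · exact key n x
    · rw [← key n (x + _)]; simp

lemma IsPeriodic.vadd {α : Type*} {f : E d → α} (hf : IsPeriodic f) (v : lattice d) (x : E d) :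
    f (v +ᵥ x) = f x := by
  rw [Submodule.vadd_def, vadd_eq_add, add_comm]; exact hf.add_lattice v.2 x

lemma exists_add_lattice_mem_cell (x : E d) : ∃ v ∈ lattice d, x + v ∈ cell d := by
  refine ⟨-(ZSpan.floor (stdBasis d) x : E d), ?_, ?_⟩
  · exact neg_mem (ZSpan.floor (stdBasis d) x).2
  · rw [cell_eq, ← sub_eq_add_neg]; exact ZSpan.fract_mem_fundamentalDomain (stdBasis d) x

lemma norm_le_of_mem_cell {x : E d} (hx : x ∈ cell d) : ‖x‖ ≤ d := by
  rw [cell_eq, ← ZSpan.fract_eq_self] at hx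
  rw [← hx]
  refine (ZSpan.norm_fract_le _ _).trans ?_
  simp [stdBasis_apply]

lemma IsPeriodic.forall_of_cell {f : E d → Prop} (hf : IsPeriodic f) (h : ∀ x ∈ cell d, f x)
    (x : E d) : f x := by
  obtain ⟨v, hv, hx⟩ := exists_add_lattice_mem_cell x
  rw [← hf.add_lattice hv]; exact h _ hx

lemma setLIntegral_eq_tsum_lattice {f : E d → ℝ≥0∞} (hf : IsPeriodic f) (s : Set (E d)) :
    ∫⁻ x in s, f x = ∑' v : lattice d, ∫⁻ x in (v +ᵥ s) ∩ cell d, f x := by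
  rw [(isAddFundamentalDomain_cell (d := d)).setLIntegral_eq_tsum' f s]
  simp [hf.vadd]

/-- The integral of a periodic function over a set that meets each lattice orbit at most once is
at most its integral over the period cell. -/
lemma setLIntegral_le_of_injOn_orbits {f : E d → ℝ≥0∞} (hf : IsPeriodic f) {s : Set (E d)}
    (hs : MeasurableSet s) (hinj : ∀ x ∈ s, ∀ v ∈ lattice d, x + v ∈ s → v = 0) :
    ∫⁻ x in s, f x ≤ ∫⁻ x, f x ∂(cellMeasure d) := by
  rw [setLIntegral_eq_tsum_lattice hf]
  rw [← lintegral_iUnion]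
  · exact lintegral_mono_set (iUnion_subset fun v => inter_subset_right)
  · exact fun v => (hs.const_vadd (v : E d)).inter measurableSet_cell
  · intro v w hvw
    refine Set.disjoint_left.2 fun x hx hy => hvw ?_
    obtain ⟨⟨a, ha, rfl⟩, -⟩ := hx
    obtain ⟨⟨b, hb, hab⟩, -⟩ := hy
    simp only [vadd_eq_add] at hab
    have : b = a + ((v : E d) - w) := by
      rw [add_sub, add_comm a, ← hab]; simp
    have h0 := hinj a ha _ (sub_mem v.2 w.2) (this ▸ hb)
    exact Subtype.ext (sub_eq_zero.1 h0)

/-- Only finitely many lattice translates of the cell meet the ball, and n bounds their number. -/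
lemma exists_setLIntegral_ball_le (d : ℕ) (R : ℝ) : ∃ n : ℕ, ∀ f : E d → ℝ≥0∞, IsPeriodic f →
    ∫⁻ x in Metric.ball 0 R, f x ≤ n * ∫⁻ x, f x ∂(cellMeasure d) := by
  have hfin : {v : lattice d | ‖(v : E d)‖ < R + d}.Finite := by
    have := ZSpan.setFinite_inter (stdBasis d) (s := Metric.ball 0 (R + d)) Metric.isBounded_ball
    refine Set.Finite.of_finite_image (f := Subtype.val) (this.subset ?_) Subtype.val_injective.injOn
    rintro _ ⟨v, hv, rfl⟩
    exact ⟨by simpa using hv, v.2⟩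
  refine ⟨hfin.toFinset.card, fun f hf => ?_⟩
  rw [setLIntegral_eq_tsum_lattice hf, tsum_eq_sum (s := hfin.toFinset)]
  · rw [← nsmul_eq_mul]
    exact Finset.sum_le_card_nsmul _ _ _ fun v _ => lintegral_mono_set inter_subset_right
  · intro v hv
    have : (v +ᵥ Metric.ball (0 : E d) R) ∩ cell d = ∅ := by
      by_contra hne
      obtain ⟨x, ⟨a, ha, rfl⟩, hx⟩ := Set.nonempty_iff_ne_empty.2 hne
      apply hv
      have h1 := norm_le_of_mem_cell hx
      simp only [vadd_eq_add] at h1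
      simp only [mem_ball_zero_iff] at ha
      have : ‖(v : E d)‖ ≤ ‖(v : E d) + a‖ + ‖a‖ := by
        simpa using norm_sub_le ((v : E d) + a) a
      simp only [Finite.mem_toFinset, mem_ofPred_eq]
      linarith
    rw [this]; simp

/-! ### The maximal function on the torus -/

/-- The integral of `f (x + s z)` over `z` in the unit ball. -/
def ballMean (f : E d → ℝ≥0∞) (s : ℝ) (x : E d) : ℝ≥0∞ :=
  ∫⁻ z in Metric.closedBall (0 : E d) 1, f (x + s • z)

/-- The maximal function over balls of radius at most `R`, without the normalizing factor given
by the volume of the unit ball. -/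
def maxFun (R : ℝ) (f : E d → ℝ≥0∞) (x : E d) : ℝ≥0∞ :=
  ⨆ s ∈ Ioc (0 : ℝ) R, ballMean f s x

lemma setLIntegral_closedBall_eq (g : E d → ℝ≥0∞) (x : E d) {s : ℝ} (hs : 0 < s) :
    ∫⁻ z in Metric.closedBall x s, g z = ENNReal.ofReal (s ^ d) * ballMean g s x := by
  have hmap : Measure.map (fun z : E d => x + s • z) volume
      = ENNReal.ofReal ((s ^ d)⁻¹) • (volume : Measure (E d)) := by
    have h1 : (fun z : E d => x + s • z) = (fun z => x + z) ∘ (fun z => s • z) := rfl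
    rw [h1, ← Measure.map_map (measurable_const_add x) (measurable_const_smul s),
      Measure.map_addHaar_smul volume hs.ne', Measure.map_smul,
      (measurePreserving_add_left volume x).map_eq]
    congr 2
    simp [abs_of_pos (pow_pos hs d)]
  have hemb : MeasurableEmbedding (fun z : E d => x + s • z) :=
    (measurableEmbedding_addLeft x).comp (measurableEmbedding_const_smul₀ hs.ne')
  have hpre : (fun z : E d => x + s • z) ⁻¹' Metric.closedBall x s = Metric.closedBall 0 1 := by
    ext z
    simp only [mem_preimage, Metric.mem_closedBall, dist_self_add_left, norm_smul,
      Real.norm_eq_abs, abs_of_pos hs, dist_zero_right]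
    exact mul_le_iff_le_one_right hs
  have h2 := hemb.lintegral_map (μ := volume.restrict (Metric.closedBall 0 1)) g
  have h3 : Measure.map (fun z : E d => x + s • z) (volume.restrict (Metric.closedBall 0 1))
      = ENNReal.ofReal ((s ^ d)⁻¹) • volume.restrict (Metric.closedBall x s) := by
    rw [← hpre, ← hemb.restrict_map, hmap, Measure.restrict_smul]
  rw [h3, lintegral_smul_measure, smul_eq_mul] at h2
  rw [ballMean, ← h2, ← mul_assoc, ← ENNReal.ofReal_mul (by positivity),
    mul_inv_cancel₀ (by positivity), ENNReal.ofReal_one, one_mul]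

lemma volume_closedBall_eq (x : E d) {s : ℝ} (hs : 0 ≤ s) :
    volume (Metric.closedBall x s)
      = ENNReal.ofReal (s ^ d) * volume (Metric.closedBall (0 : E d) 1) := by
  simpa using Measure.addHaar_closedBall' volume x hs

lemma continuous_ballMean {f : E d → ℝ≥0∞} (hf : Continuous f) {B : ℝ≥0∞} (hB : B ≠ ∞)
    (hfB : ∀ x, f x ≤ B) (s : ℝ) : Continuous (ballMean f s) := by
  rw [continuous_iff_continuousAt]
  intro x
  refine tendsto_lintegral_filter_of_dominated_convergence (fun _ => B) ?_ ?_ ?_ ?_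
  · exact Filter.Eventually.of_forall fun y => (hf.comp (by fun_prop)).measurable
  · exact Filter.Eventually.of_forall fun y => Filter.Eventually.of_forall fun z => hfB _
  · simp only [lintegral_const, Measure.restrict_apply_univ]
    exact ENNReal.mul_ne_top hB measure_closedBall_lt_top.ne
  · refine Filter.Eventually.of_forall fun z => ?_
    exact (hf.comp (by fun_prop : Continuous fun y : E d => y + s • z)).continuousAt

/-- A supremum of uncountably many continuous functions is still lower semicontinuous. -/
lemma measurable_maxFun {f : E d → ℝ≥0∞} (hf : Continuous f) {B : ℝ≥0∞} (hB : B ≠ ∞)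
    (hfB : ∀ x, f x ≤ B) (R : ℝ) : Measurable (maxFun R f) := by
  have : LowerSemicontinuous (maxFun R f) :=
    lowerSemicontinuous_biSup fun s _ => (continuous_ballMean hf hB hfB s).lowerSemicontinuous
  exact this.measurable

lemma IsPeriodic.maxFun {f : E d → ℝ≥0∞} (hf : IsPeriodic f) (R : ℝ) :
    IsPeriodic (maxFun R f) := by
  intro i x
  simp only [Mixing.maxFun, ballMean]
  simp only [fun z : E d => add_right_comm x (EuclideanSpace.single i 1) z, hf i]

lemma maxFun_le {f : E d → ℝ≥0∞} {B : ℝ≥0∞} (hfB : ∀ x, f x ≤ B) (R : ℝ) (x : E d) :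
    maxFun R f x ≤ B * volume (Metric.closedBall (0 : E d) 1) := by
  refine iSup₂_le fun s _ => ?_
  calc ballMean f s x ≤ ∫⁻ z in Metric.closedBall (0 : E d) 1, B := lintegral_mono fun z => hfB _
    _ = _ := by simp

/-- The weak `L¹` estimate for the maximal function. -/
lemma exists_weak_type_maxFun (d : ℕ) (R : ℝ) : ∃ n : ℕ, ∀ f : E d → ℝ≥0∞, Measurable f →
    IsPeriodic f → ∀ l : ℝ≥0∞,
      l * cellMeasure d {x | l < maxFun R f x} ≤ n * ∫⁻ x, f x ∂(cellMeasure d) := by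
  -- Balls of radius at most R centred in the cell stay within distance d + R of the origin; the
  -- extra 1 puts them in an open ball.
  obtain ⟨n, hn⟩ := exists_setLIntegral_ball_le d (d + R + 1)
  obtain ⟨m, hm⟩ := exists_nat_gt
    (5 ^ d * (volume (Metric.closedBall (0 : E d) 1)).toReal)
  refine ⟨m * n, fun f hfm hf l => ?_⟩
  set S := {x | l < maxFun R f x} ∩ cell d with hS
  have hVm : 5 ^ d * volume (Metric.closedBall (0 : E d) 1) ≤ m := by
    rw [← ENNReal.ofReal_toReal
      (measure_closedBall_lt_top (μ := volume) (x := (0 : E d)) (r := 1)).ne]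
    rw [← ENNReal.ofReal_natCast, show (5 : ℝ≥0∞) ^ d = ENNReal.ofReal (5 ^ d) by
      rw [ENNReal.ofReal_pow (by norm_num)]; norm_num, ← ENNReal.ofReal_mul (by positivity)]
    exact ENNReal.ofReal_le_ofReal hm.le
  have hr : ∀ x : E d, ∃ s : ℝ, x ∈ S → s ∈ Ioc 0 R ∧
      l * ENNReal.ofReal (s ^ d) ≤ ∫⁻ z in Metric.closedBall x s, f z := by
    intro x
    by_cases hx : x ∈ S
    · obtain ⟨s, hs, hls⟩ : ∃ s ∈ Ioc 0 R, l < ballMean f s x := by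
        have := hx.1
        simpa only [mem_ofPred_eq, maxFun, lt_iSup_iff, exists_prop] using this
      refine ⟨s, fun _ => ⟨hs, ?_⟩⟩
      rw [setLIntegral_closedBall_eq f x hs.1, mul_comm]
      gcongr
    · exact ⟨0, fun h => absurd h hx⟩
  choose r hr using hr
  -- Vitali covering: disjoint balls whose fivefold enlargements cover S, whence the factor 5 ^ d in
  -- the choice of m.
  obtain ⟨u, huS, hdisj, hcov⟩ := Vitali.exists_disjoint_subfamily_covering_enlargement_closedBall
    S id r R (fun a ha => (hr a ha).1.2) 5 (by norm_num)
  simp only [id] at hdisj hcov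
  have hu : u.Countable := by
    refine hdisj.countable_of_nonempty_interior fun a ha => ?_
    refine ⟨a, ?_⟩
    exact Metric.ball_subset_interior_closedBall (Metric.mem_ball_self (hr a (huS ha)).1.1)
  have hSsub : S ⊆ ⋃ b ∈ u, Metric.closedBall b (5 * r b) := by
    intro a ha
    obtain ⟨b, hb, hab⟩ := hcov a ha
    exact mem_biUnion hb (hab (Metric.mem_closedBall_self (hr a ha).1.1.le))
  have hvol : cellMeasure d {x | l < maxFun R f x} = volume S := by
    rw [cellMeasure, Measure.restrict_apply' measurableSet_cell]
  rw [hvol]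
  calc l * volume S
      ≤ l * ∑' b : u, volume (Metric.closedBall (b : E d) (5 * r b)) := by
        gcongr
        exact (measure_mono hSsub).trans (measure_biUnion_le _ hu _)
    _ = ∑' b : u, l * volume (Metric.closedBall (b : E d) (5 * r b)) := ENNReal.tsum_mul_left.symm
    _ ≤ ∑' b : u, m * ∫⁻ z in Metric.closedBall (b : E d) (r b), f z := by
        refine ENNReal.tsum_le_tsum fun b => ?_
        obtain ⟨hb1, hb2⟩ := hr b (huS b.2)
        rw [volume_closedBall_eq _ (by linarith [hb1.1]), mul_pow,
          ENNReal.ofReal_mul (by positivity), ENNReal.ofReal_pow (by norm_num : (0:ℝ) ≤ 5)]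
        calc _ = (5 ^ d * volume (Metric.closedBall (0 : E d) 1))
              * (l * ENNReal.ofReal (r b ^ d)) := by norm_num; ring
          _ ≤ _ := by gcongr
    _ = m * ∑' b : u, ∫⁻ z in Metric.closedBall (b : E d) (r b), f z := ENNReal.tsum_mul_left
    _ = m * ∫⁻ z in ⋃ b ∈ u, Metric.closedBall (b : E d) (r b), f z := by
        rw [lintegral_biUnion hu (fun _ _ => measurableSet_closedBall) hdisj]
    _ ≤ m * ∫⁻ z in Metric.ball 0 (d + R + 1), f z := by
        gcongr
        refine iUnion₂_subset fun b hb z hz => ?_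
        have h1 := norm_le_of_mem_cell (huS hb).2
        have h2 := (hr b (huS hb)).1.2
        have h3 : ‖z - b‖ ≤ r b := by simpa [dist_eq_norm] using hz
        have h4 := norm_le_norm_add_norm_sub b z
        rw [norm_sub_rev] at h4
        rw [mem_ball_zero_iff]
        linarith
    _ ≤ m * (n * ∫⁻ x, f x ∂(cellMeasure d)) := by gcongr; exact hn f hf
    _ = _ := by push_cast; ring

/-- Only the mean of the maximal function is needed, so a weak (p, p) bound is enough: on a
probability space its tail l ^ (-p) is integrable at infinity because p > 1. -/
lemma exists_lintegral_maxFun_le (d : ℕ) (R : ℝ) {p : ℝ} (hp : 1 < p) : ∃ C : ℝ, 0 < C ∧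
    ∀ f : E d → ℝ≥0∞, Continuous f → IsPeriodic f → ∀ B : ℝ≥0∞, B ≠ ∞ → (∀ x, f x ≤ B) →
      ∫⁻ x, maxFun R f x ∂(cellMeasure d)
        ≤ ENNReal.ofReal C * (∫⁻ x, f x ^ p ∂(cellMeasure d)) ^ (1 / p) := by
  obtain ⟨n, hn⟩ := exists_weak_type_maxFun d R
  set V := volume (Metric.closedBall (0 : E d) 1) with hV
  have hVtop : V ≠ ∞ := measure_closedBall_lt_top.ne
  have hV0 : V ≠ 0 := (Metric.measure_closedBall_pos _ _ one_pos).ne'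
  set v := V.toReal with hv
  have hv0 : 0 < v := ENNReal.toReal_pos hV0 hVtop
  -- the weak type `(p, p)` estimate
  have weak : ∀ f : E d → ℝ≥0∞, Continuous f → IsPeriodic f → ∀ l : ℝ, 0 < l →
      cellMeasure d {x | ENNReal.ofReal l < maxFun R f x} ≤
        ENNReal.ofReal (2 * n * (2 * v) ^ (p - 1) * l ^ (-p))
          * ∫⁻ x, f x ^ p ∂(cellMeasure d) := by
    intro f hfc hf l hl
    -- Truncation height: since `ballMean` is not normalized, the constant a contributes a * v = l /
    -- 2. The part of f above a must account for the other half of l.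
    set a : ℝ := l / (2 * v) with ha
    have ha0 : 0 < a := by positivity
    set g : E d → ℝ≥0∞ := {x | ENNReal.ofReal a < f x}.indicator f with hg
    have hgm : Measurable g :=
      hfc.measurable.indicator (measurableSet_lt measurable_const hfc.measurable)
    have hgp : IsPeriodic g := by
      intro i x
      simp only [hg, indicator_apply, mem_ofPred_eq, hf i x]
    have hfg : ∀ x, f x ≤ ENNReal.ofReal a + g x := by
      intro x
      by_cases hx : ENNReal.ofReal a < f x
      · simp [hg, hx]
      · exact (not_lt.1 hx).trans le_self_add
    have hmean : ∀ s x, ballMean f s x ≤ ENNReal.ofReal (l / 2) + ballMean g s x := by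
      intro s x
      calc ballMean f s x
          ≤ ∫⁻ z in Metric.closedBall (0 : E d) 1, (ENNReal.ofReal a + g (x + s • z)) :=
            lintegral_mono fun z => hfg _
        _ = ENNReal.ofReal a * V + ballMean g s x := by
            rw [lintegral_add_left measurable_const]; simp [ballMean, hV]
        _ = _ := by
            rw [← ENNReal.ofReal_toReal hVtop, ← ENNReal.ofReal_mul ha0.le]
            congr 2
            rw [ha, ← hv]; field_simp
    have hmax : ∀ x, maxFun R f x ≤ ENNReal.ofReal (l / 2) + maxFun R g x := by
      intro x
      refine iSup₂_le fun s hs => (hmean s x).trans ?_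
      gcongr
      exact le_iSup₂ (f := fun s (_ : s ∈ Ioc (0 : ℝ) R) => ballMean g s x) s hs
    have hsub : {x | ENNReal.ofReal l < maxFun R f x} ⊆
        {x | ENNReal.ofReal (l / 2) < maxFun R g x} := by
      intro x hx
      simp only [mem_ofPred_eq] at hx ⊢
      by_contra hcon
      have := hx.trans_le ((hmax x).trans (add_le_add_right (not_lt.1 hcon) _))
      rw [← ENNReal.ofReal_add (by positivity) (by positivity), add_halves] at this
      exact lt_irrefl _ this
    -- Where f > a, the factor (f / a) ^ (p - 1) exceeds 1; this converts the weak L¹ bound for g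
    -- into an L^p bound for f.
    have hgf : ∀ x, g x ≤ ENNReal.ofReal (a ^ (1 - p)) * f x ^ p := by
      intro x
      by_cases hx : ENNReal.ofReal a < f x
      · simp only [hg, indicator, mem_ofPred_eq, hx, if_true]
        rcases eq_or_ne (f x) ∞ with h | h
        · rw [h, ENNReal.top_rpow_of_pos (by linarith), ENNReal.mul_top]
          simpa using Real.rpow_pos_of_pos ha0 _
        · obtain ⟨y, hy⟩ : ∃ y : ℝ, f x = ENNReal.ofReal y := ⟨_, (ENNReal.ofReal_toReal h).symm⟩
          rw [hy] at hx ⊢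
          have hay : a < y := (ENNReal.ofReal_lt_ofReal_iff_of_nonneg ha0.le).1 hx
          have hy0 := ha0.trans hay
          rw [ENNReal.ofReal_rpow_of_pos hy0, ← ENNReal.ofReal_mul (by positivity)]
          apply ENNReal.ofReal_le_ofReal
          calc y = y ^ (1 - p) * y ^ p := by rw [← Real.rpow_add hy0]; simp
            _ ≤ _ := by
              gcongr ?_ * _
              exact Real.rpow_le_rpow_of_nonpos ha0 hay.le (by linarith)
      · simp [hg, hx]
    have h1 := hn g hgm hgp (ENNReal.ofReal (l / 2))
    have h2 : ∫⁻ x, g x ∂(cellMeasure d) ≤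
        ENNReal.ofReal (a ^ (1 - p)) * ∫⁻ x, f x ^ p ∂(cellMeasure d) := by
      rw [← lintegral_const_mul _ (hfc.measurable.pow_const p)]
      exact lintegral_mono hgf
    have hl2 : ENNReal.ofReal (2 / l) * ENNReal.ofReal (l / 2) = 1 := by
      rw [← ENNReal.ofReal_mul (by positivity)]
      simp [hl.ne']
    calc cellMeasure d {x | ENNReal.ofReal l < maxFun R f x}
        ≤ cellMeasure d {x | ENNReal.ofReal (l / 2) < maxFun R g x} := measure_mono hsub
      _ = ENNReal.ofReal (2 / l) * (ENNReal.ofReal (l / 2) *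
            cellMeasure d {x | ENNReal.ofReal (l / 2) < maxFun R g x}) := by
          rw [← mul_assoc, hl2, one_mul]
      _ ≤ ENNReal.ofReal (2 / l) * (n * (ENNReal.ofReal (a ^ (1 - p)) *
            ∫⁻ x, f x ^ p ∂(cellMeasure d))) := by exact mul_le_mul_right (h1.trans (by gcongr)) _
      _ = _ := by
          rw [← ENNReal.ofReal_natCast, ← mul_assoc, ← mul_assoc,
            ← ENNReal.ofReal_mul (by positivity), ← ENNReal.ofReal_mul (by positivity)]
          congr 2
          rw [ha, Real.div_rpow hl.le (by positivity), Real.rpow_sub hl, Real.rpow_one,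
            Real.rpow_neg hl.le, show 1 - p = -(p - 1) by ring,
            Real.rpow_neg (by positivity : 0 ≤ 2 * v)]
          have := Real.rpow_pos_of_pos hl p
          have := Real.rpow_pos_of_pos (by positivity : 0 < 2 * v) (p - 1)
          field_simp
  set K : ℝ := 2 * n * (2 * v) ^ (p - 1) with hK
  have hK0 : 0 ≤ K := by positivity
  have hp1 : 0 < p - 1 := by linarith
  refine ⟨1 + K / (p - 1), by positivity, fun f hfc hf B hB hfB => ?_⟩
  set I := ∫⁻ x, f x ^ p ∂(cellMeasure d) with hI
  have hItop : I ≠ ∞ := by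
    refine ne_top_of_le_ne_top ?_ (lintegral_mono fun x => ENNReal.rpow_le_rpow (hfB x) (by linarith))
    simpa using ENNReal.rpow_ne_top_of_nonneg (by linarith) hB
  have hMtop : ∀ x, maxFun R f x ≠ ∞ := fun x =>
    ne_top_of_le_ne_top (ENNReal.mul_ne_top hB hVtop) (maxFun_le hfB R x)
  have hMm := measurable_maxFun hfc hB hfB R
  -- the bound by any `b` with `I ≤ b ^ p`
  have key : ∀ b : ℝ, 0 < b → I ≤ ENNReal.ofReal (b ^ p) →
      ∫⁻ x, maxFun R f x ∂(cellMeasure d) ≤ ENNReal.ofReal ((1 + K / (p - 1)) * b) := by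
    intro b hb hIb
    have hlc : ∫⁻ x, maxFun R f x ∂(cellMeasure d) =
        ∫⁻ l in Ioi 0, cellMeasure d {x | l < (maxFun R f x).toReal} := by
      rw [← lintegral_eq_lintegral_meas_lt _ (Filter.Eventually.of_forall fun _ =>
        ENNReal.toReal_nonneg) hMm.ennreal_toReal.aemeasurable]
      simp_rw [ENNReal.ofReal_toReal (hMtop _)]
    have hset : ∀ l : ℝ, 0 < l → cellMeasure d {x | l < (maxFun R f x).toReal} ≤
        ENNReal.ofReal (K * b ^ p * l ^ (-p)) := by
      intro l hl
      have : {x | l < (maxFun R f x).toReal} = {x | ENNReal.ofReal l < maxFun R f x} := by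
        ext x
        simp only [mem_ofPred_eq]
        rw [ENNReal.ofReal_lt_iff_lt_toReal hl.le (hMtop x)]
      rw [this]
      refine (weak f hfc hf l hl).trans ?_
      calc _ ≤ ENNReal.ofReal (K * l ^ (-p)) * ENNReal.ofReal (b ^ p) := by gcongr
        _ = _ := by
          rw [← ENNReal.ofReal_mul (by positivity)]; congr 1; ring
    -- Layer cake split at b: levels below b contribute at most b since the total mass is 1, levels
    -- above b contribute K * b / (p - 1) by the weak bound.
    rw [hlc, ← Ioc_union_Ioi_eq_Ioi hb.le]
    refine (lintegral_union_le _ _ _).trans ?_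
    rw [add_mul, ENNReal.ofReal_add (by positivity) (by positivity)]
    gcongr
    · calc _ ≤ ∫⁻ l in Ioc 0 b, 1 := lintegral_mono fun l => prob_le_one
        _ = _ := by simp
    · have hint := integrableOn_Ioi_rpow_of_lt (a := -p) (by linarith) hb
      calc _ ≤ ∫⁻ l in Ioi b, ENNReal.ofReal (K * b ^ p * l ^ (-p)) :=
            setLIntegral_mono' measurableSet_Ioi fun l hl => hset l (hb.trans hl)
        _ = ENNReal.ofReal (∫ l in Ioi b, K * b ^ p * l ^ (-p)) := by
            rw [ofReal_integral_eq_lintegral_ofReal (hint.const_mul _)]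
            filter_upwards [ae_restrict_mem measurableSet_Ioi] with l hl
            have : 0 < l := hb.trans hl
            positivity
        _ = _ := by
            rw [integral_const_mul, integral_Ioi_rpow_of_lt (by linarith) hb]
            congr 1
            have : b ^ (-p + 1) = b / b ^ p := by
              rw [Real.rpow_add hb, Real.rpow_one, Real.rpow_neg hb.le]; field_simp
            rw [this]
            have hbp := Real.rpow_pos_of_pos hb p
            have h3 : -p + 1 ≠ 0 := by linarith
            rw [show -p + 1 = -(p - 1) by ring]
            field_simp
  set A : ℝ := (I ^ (1 / p)).toReal with hA
  have hAtop : I ^ (1 / p) ≠ ∞ := ENNReal.rpow_ne_top_of_nonneg (by positivity) hItop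
  rw [← ENNReal.ofReal_toReal hAtop, ← ENNReal.ofReal_mul (by positivity)]
  -- The optimal b is the L^p norm A, but `key` needs b > 0 and A may vanish; hence b decreases to
  -- A.
  have hlim : Filter.Tendsto (fun b : ℝ => ENNReal.ofReal ((1 + K / (p - 1)) * b))
      (nhdsWithin A (Ioi A)) (nhds (ENNReal.ofReal ((1 + K / (p - 1)) * A))) := by
    apply ENNReal.tendsto_ofReal
    exact (Continuous.tendsto (by fun_prop) A).mono_left nhdsWithin_le_nhds
  refine ge_of_tendsto hlim ?_
  filter_upwards [self_mem_nhdsWithin] with b hb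
  have hA0 : 0 ≤ A := ENNReal.toReal_nonneg
  have hb0 : 0 < b := hA0.trans_lt hb
  refine key b hb0 ?_
  have : I = (I ^ (1 / p)) ^ p := by
    rw [← ENNReal.rpow_mul, one_div_mul_cancel (by linarith), ENNReal.rpow_one]
  rw [this, ← ENNReal.ofReal_rpow_of_pos hb0]
  apply ENNReal.rpow_le_rpow _ (by linarith)
  rw [← ENNReal.ofReal_toReal hAtop]
  exact ENNReal.ofReal_le_ofReal (le_of_lt hb)

/-! ### Pointwise Lipschitz bounds from the maximal function -/

lemma IsPeriodic.comp {α β : Type*} {f : E d → α} (hf : IsPeriodic f) (g : α → β) :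
    IsPeriodic (fun x => g (f x)) := fun i x => congrArg g (hf i x)

lemma IsPeriodic.fderiv {F : Type*} [NormedAddCommGroup F] [NormedSpace ℝ F] {f : E d → F}
    (hf : IsPeriodic f) : IsPeriodic (fderiv ℝ f) := by
  intro i x
  rw [← fderiv_comp_add_right]
  congr 1
  funext y
  exact hf i y

lemma IsPeriodic.exists_norm_le {F : Type*} [NormedAddCommGroup F] {f : E d → F}
    (hf : IsPeriodic f) (hc : Continuous f) : ∃ B : ℝ, 0 ≤ B ∧ ∀ x, ‖f x‖ ≤ B := by
  obtain ⟨B, hB⟩ := (isCompact_closedBall (0 : E d) d).exists_bound_of_continuousOn hc.continuousOn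
  refine ⟨B, (norm_nonneg _).trans (hB 0 (by simp)), ?_⟩
  refine (hf.comp fun y => ‖y‖ ≤ B).forall_of_cell fun x hx => hB x ?_
  simpa using norm_le_of_mem_cell hx

lemma enorm_add_sub_le_lintegral {F : Type*} [NormedAddCommGroup F] [NormedSpace ℝ F]
    [CompleteSpace F] {v : E d → F} (hv : ContDiff ℝ 1 v) (x a : E d) :
    ‖v (x + a) - v x‖ₑ ≤ ∫⁻ s in Ioc (0 : ℝ) 1, ‖fderiv ℝ v (x + s • a)‖ₑ * ‖a‖ₑ := by
  have hc : Continuous (fderiv ℝ v) := hv.continuous_fderiv (by norm_num)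
  have hd : ∀ s ∈ uIcc (0 : ℝ) 1,
      HasDerivAt (fun s : ℝ => v (x + s • a)) (fderiv ℝ v (x + s • a) a) s := by
    intro s _
    have h1 : HasDerivAt (fun s : ℝ => x + s • a) a s := by
      simpa using ((hasDerivAt_id s).smul_const a).const_add x
    exact ((hv.differentiable (by norm_num)) _).hasFDerivAt.comp_hasDerivAt s h1
  have hint := intervalIntegral.integral_eq_sub_of_hasDerivAt hd
    (Continuous.intervalIntegrable (by fun_prop) _ _)
  simp only [one_smul, zero_smul, add_zero] at hint
  rw [← hint, intervalIntegral.integral_of_le zero_le_one]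
  refine (enorm_integral_le_lintegral_enorm _).trans (lintegral_mono fun s => ?_)
  exact ContinuousLinearMap.le_opENorm _ _

/-- Integrate the gradient along the segments issuing from x and exchange the integrals: at a fixed
segment parameter s the inner integral is a mean over the ball of radius s * r ≤ R. -/
lemma setLIntegral_closedBall_enorm_sub_le {v : E d → E d} (hv : ContDiff ℝ 1 v) (x : E d)
    {r R : ℝ} (hr : 0 < r) (hrR : r ≤ R) :
    ∫⁻ z in Metric.closedBall x r, ‖v z - v x‖ₑ ≤
      ENNReal.ofReal (r ^ d) * (ENNReal.ofReal r * maxFun R (fun y => ‖fderiv ℝ v y‖ₑ) x) := by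
  have hc : Continuous (fderiv ℝ v) := hv.continuous_fderiv (by norm_num)
  rw [setLIntegral_closedBall_eq _ x hr]
  gcongr
  set f : E d → ℝ≥0∞ := fun y => ‖fderiv ℝ v y‖ₑ with hf
  have hfc : Continuous f := hc.enorm
  calc ballMean (fun z => ‖v z - v x‖ₑ) r x
      ≤ ∫⁻ z in Metric.closedBall (0 : E d) 1, ∫⁻ s in Ioc (0 : ℝ) 1,
          ENNReal.ofReal r * f (x + (s * r) • z) := by
        refine setLIntegral_mono' measurableSet_closedBall fun z hz => ?_
        refine (enorm_add_sub_le_lintegral hv x (r • z)).trans (lintegral_mono fun s => ?_)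
        rw [mul_comm, mul_smul]
        gcongr
        rw [← ofReal_norm]
        apply ENNReal.ofReal_le_ofReal
        rw [norm_smul, Real.norm_eq_abs, abs_of_pos hr]
        exact mul_le_of_le_one_right hr.le (by simpa using hz)
    _ = ∫⁻ s in Ioc (0 : ℝ) 1, ∫⁻ z in Metric.closedBall (0 : E d) 1,
          ENNReal.ofReal r * f (x + (s * r) • z) := by
        refine lintegral_lintegral_swap ?_
        refine (Measurable.const_mul ?_ _).aemeasurable
        exact (hfc.comp (by fun_prop)).measurable
    _ ≤ ∫⁻ s in Ioc (0 : ℝ) 1, ENNReal.ofReal r * maxFun R f x := by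
        refine setLIntegral_mono' measurableSet_Ioc fun s hs => ?_
        have hm : Measurable fun z : E d => f (x + (s * r) • z) :=
          (hfc.comp (by fun_prop)).measurable
        rw [lintegral_const_mul _ hm]
        gcongr
        refine le_iSup₂ (f := fun s (_ : s ∈ Ioc (0 : ℝ) R) => ballMean f s x) (s * r) ⟨?_, ?_⟩
        · exact mul_pos hs.1 hr
        · exact (mul_le_of_le_one_left hr.le hs.2).trans hrR
    _ = _ := by simp

/-- Lipschitz estimate by the maximal function, at distances at most `R`. -/
lemma enorm_sub_le_maxFun {v : E d → E d} (hv : ContDiff ℝ 1 v) {x y : E d} {R : ℝ}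
    (hxy : ‖x - y‖ ≤ R) :
    ENNReal.ofReal ((1 / 2) ^ d) * volume (Metric.closedBall (0 : E d) 1) * ‖v x - v y‖ₑ ≤
      ‖x - y‖ₑ * (maxFun R (fun z => ‖fderiv ℝ v z‖ₑ) x + maxFun R (fun z => ‖fderiv ℝ v z‖ₑ) y) := by
  rcases eq_or_ne x y with rfl | hne
  · simp
  set r := ‖x - y‖ with hr
  have hr0 : 0 < r := by simpa [hr, sub_eq_zero] using hne
  -- The ball of radius r / 2 about the midpoint lies in both balls of radius r, so v x and v y can
  -- be compared through the values of v on it.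
  set m := midpoint ℝ x y with hm
  have hmx : Metric.closedBall m (r / 2) ⊆ Metric.closedBall x r := by
    refine Metric.closedBall_subset_closedBall' ?_
    rw [hm, dist_midpoint_left, dist_eq_norm, ← hr]
    norm_num; linarith
  have hmy : Metric.closedBall m (r / 2) ⊆ Metric.closedBall y r := by
    refine Metric.closedBall_subset_closedBall' ?_
    rw [hm, dist_midpoint_right, dist_eq_norm, ← hr]
    norm_num; linarith
  have hcont : Continuous v := hv.continuous
  have h1 : volume (Metric.closedBall m (r / 2)) * ‖v x - v y‖ₑ ≤
      ENNReal.ofReal (r ^ d) * (ENNReal.ofReal r * maxFun R (fun z => ‖fderiv ℝ v z‖ₑ) x) +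
      ENNReal.ofReal (r ^ d) * (ENNReal.ofReal r * maxFun R (fun z => ‖fderiv ℝ v z‖ₑ) y) :=
    calc _ = ∫⁻ z in Metric.closedBall m (r / 2), ‖v x - v y‖ₑ := by simp [mul_comm]
      _ ≤ ∫⁻ z in Metric.closedBall m (r / 2), (‖v z - v x‖ₑ + ‖v z - v y‖ₑ) := by
          refine lintegral_mono fun z => ?_
          have : v x - v y = (v z - v y) - (v z - v x) := by abel
          simp only [this]
          rw [add_comm]
          exact enorm_sub_le
      _ = (∫⁻ z in Metric.closedBall m (r / 2), ‖v z - v x‖ₑ) +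
            ∫⁻ z in Metric.closedBall m (r / 2), ‖v z - v y‖ₑ :=
          lintegral_add_left (by fun_prop) _
      _ ≤ (∫⁻ z in Metric.closedBall x r, ‖v z - v x‖ₑ) +
            ∫⁻ z in Metric.closedBall y r, ‖v z - v y‖ₑ :=
          add_le_add (lintegral_mono_set hmx) (lintegral_mono_set hmy)
      _ ≤ _ := add_le_add (setLIntegral_closedBall_enorm_sub_le hv x hr0 hxy)
          (setLIntegral_closedBall_enorm_sub_le hv y hr0 hxy)
  rw [volume_closedBall_eq _ (by positivity), div_eq_mul_one_div r 2, mul_pow,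
    ENNReal.ofReal_mul (by positivity), mul_assoc, mul_assoc, ← mul_add] at h1
  have h2 := (ENNReal.mul_le_mul_iff_right (by simpa using pow_pos hr0 d)
    ENNReal.ofReal_ne_top).1 h1
  rw [← mul_add] at h2
  rw [← ofReal_norm (x - y), ← hr, mul_assoc]
  exact h2

/-- A smooth periodic vector field is Lipschitz with a constant that depends on the points through
a function whose mean is controlled by the `L^p` norm of the gradient. -/
lemma exists_lusin_lipschitz (d : ℕ) {p : ℝ≥0∞} (hp : 1 < p) : ∃ C : ℝ, 0 < C ∧
    ∀ v : E d → E d, ContDiff ℝ 1 v → IsPeriodic v → ∃ m : E d → ℝ, Measurable m ∧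
      IsPeriodic m ∧ (∀ x, 0 ≤ m x) ∧ (∀ x y, ‖v x - v y‖ ≤ ‖x - y‖ * (m x + m y)) ∧
      ∫⁻ x, ENNReal.ofReal (m x) ∂(cellMeasure d) ≤ ENNReal.ofReal C * gradNorm p v := by
  -- The maximal bound is for real exponents. On a probability space the L^q norm is at most the L^p
  -- norm, so any real q in (1, p] serves, in particular when p = ∞.
  obtain ⟨q, hq1, hqp⟩ : ∃ q : ℝ, 1 < q ∧ ENNReal.ofReal q ≤ p := by
    rcases eq_or_ne p ∞ with rfl | h
    · exact ⟨2, by norm_num, le_top⟩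
    · refine ⟨p.toReal, ?_, ENNReal.ofReal_toReal_le⟩
      simpa using (ENNReal.toReal_lt_toReal ENNReal.one_ne_top h).2 hp
  obtain ⟨C, hC, hmax⟩ := exists_lintegral_maxFun_le d d hq1
  set V := volume (Metric.closedBall (0 : E d) 1) with hV
  have hVtop : V ≠ ∞ := measure_closedBall_lt_top.ne
  have hV0 : V ≠ 0 := (Metric.measure_closedBall_pos _ _ one_pos).ne'
  have hv0 : 0 < V.toReal := ENNReal.toReal_pos hV0 hVtop
  set k : ℝ := (1 / 2) ^ d * V.toReal with hk
  have hk0 : 0 < k := by positivity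
  refine ⟨k⁻¹ * C, by positivity, fun v hv hper => ?_⟩
  set f : E d → ℝ≥0∞ := fun y => ‖fderiv ℝ v y‖ₑ with hf
  have hc : Continuous (fderiv ℝ v) := hv.continuous_fderiv (by norm_num)
  have hfc : Continuous f := hc.enorm
  have hfp : IsPeriodic f := hper.fderiv.comp _
  obtain ⟨B, hB0, hB⟩ := hper.fderiv.exists_norm_le hc
  have hfB : ∀ x, f x ≤ ENNReal.ofReal B := fun x => by
    simp only [hf, ← ofReal_norm]; exact ENNReal.ofReal_le_ofReal (hB x)
  have hMtop : ∀ x, maxFun d f x ≠ ∞ := fun x =>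
    ne_top_of_le_ne_top (ENNReal.mul_ne_top ENNReal.ofReal_ne_top hVtop) (maxFun_le hfB d x)
  have hMp : IsPeriodic (fun x => k⁻¹ * (maxFun d f x).toReal) :=
    (hfp.maxFun d).comp fun y : ℝ≥0∞ => k⁻¹ * y.toReal
  have hMm : Measurable (maxFun d f) := measurable_maxFun hfc ENNReal.ofReal_ne_top hfB d
  have hnear : ∀ x y, ‖x - y‖ ≤ d → ‖v x - v y‖ ≤
      ‖x - y‖ * (k⁻¹ * (maxFun d f x).toReal + k⁻¹ * (maxFun d f y).toReal) := by
    intro x y hxy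
    have h := enorm_sub_le_maxFun hv hxy
    rw [← ENNReal.ofReal_toReal (hMtop x), ← ENNReal.ofReal_toReal (hMtop y), ← hV,
      ← ENNReal.ofReal_toReal hVtop, ← ofReal_norm, ← ofReal_norm,
      ← ENNReal.ofReal_mul (by positivity), ← ENNReal.ofReal_mul (by positivity),
      ← ENNReal.ofReal_add (by positivity) (by positivity), ← ENNReal.ofReal_mul (by positivity),
      ENNReal.ofReal_le_ofReal_iff (by positivity), ← hk] at h
    rw [← mul_add, mul_left_comm, inv_mul_eq_div, le_div_iff₀' hk0]
    exact h
  refine ⟨fun x => k⁻¹ * (maxFun d f x).toReal, hMm.ennreal_toReal.const_mul _, hMp,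
    fun x => by positivity, ?_, ?_⟩
  · intro x y
    by_cases hxy : ‖x - y‖ ≤ d
    · exact hnear x y hxy
    -- For distant points, translate x by a lattice vector so that the difference falls in the cell.
    -- This leaves v and m unchanged and only shortens the distance; it is why radii up to d
    -- suffice.
    · obtain ⟨w, hw, hmem⟩ := exists_add_lattice_mem_cell (x - y)
      have h1 := norm_le_of_mem_cell hmem
      have h2 : x - y + w = (x + w) - y := by abel
      rw [h2] at h1
      have h3 := hnear (x + w) y h1
      have h4 := hMp.add_lattice hw x
      rw [hper.add_lattice hw, h4] at h3
      refine h3.trans ?_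
      gcongr
      exact h1.trans (not_le.1 hxy).le
  · have hle : (∫⁻ x, f x ^ q ∂(cellMeasure d)) ^ (1 / q) ≤ gradNorm p v := by
      have h1 : eLpNorm (fderiv ℝ v) (ENNReal.ofReal q) (cellMeasure d) ≤ gradNorm p v :=
        eLpNorm_le_eLpNorm_of_exponent_le hqp hc.aestronglyMeasurable
      rw [eLpNorm_eq_lintegral_rpow_enorm_toReal (by simpa using by linarith) ENNReal.ofReal_ne_top,
        ENNReal.toReal_ofReal (by linarith)] at h1
      exact h1
    calc ∫⁻ x, ENNReal.ofReal (k⁻¹ * (maxFun d f x).toReal) ∂(cellMeasure d)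
        = ENNReal.ofReal k⁻¹ * ∫⁻ x, maxFun d f x ∂(cellMeasure d) := by
          rw [← lintegral_const_mul _ hMm]
          refine lintegral_congr fun x => ?_
          rw [ENNReal.ofReal_mul (by positivity), ENNReal.ofReal_toReal (hMtop x)]
      _ ≤ ENNReal.ofReal k⁻¹ * (ENNReal.ofReal C * gradNorm p v) := by
          gcongr
          refine (hmax f hfc hfp _ ENNReal.ofReal_ne_top hfB).trans ?_
          gcongr
      _ = _ := by rw [← mul_assoc, ← ENNReal.ofReal_mul (by positivity)]

/-! ### Uniform bounds for smooth fields on the closed time interval -/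

section Slices

variable {W : Type*} [NormedAddCommGroup W] [NormedSpace ℝ W]

lemma contDiff_slice {T : ℝ} {G : ℝ → E d → W}
    (hG : ContDiffOn ℝ (⊤ : ℕ∞) (fun z : ℝ × E d => G z.1 z.2) (Icc 0 T ×ˢ univ)) {t : ℝ}
    (ht : t ∈ Icc 0 T) : ContDiff ℝ (⊤ : ℕ∞) (G t) := by
  rw [← contDiffOn_univ]
  exact hG.comp (f := fun x : E d => (t, x)) (by fun_prop) fun x _ => ⟨ht, mem_univ x⟩

/-- Smoothness is known only on the closed strip, so joint regularity of the spatial derivative has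
to be read off from the derivative within that strip. -/
lemma fderiv_slice_eq {T : ℝ} {G : ℝ → E d → W}
    (hG : ContDiffOn ℝ (⊤ : ℕ∞) (fun z : ℝ × E d => G z.1 z.2) (Icc 0 T ×ˢ univ)) {t : ℝ}
    (ht : t ∈ Icc 0 T) (x : E d) :
    fderiv ℝ (G t) x = (fderivWithin ℝ (fun z : ℝ × E d => G z.1 z.2) (Icc 0 T ×ˢ univ) (t, x)).comp
      (ContinuousLinearMap.inr ℝ ℝ (E d)) := by
  have h1 : HasFDerivWithinAt (fun z : ℝ × E d => G z.1 z.2) _ (Icc 0 T ×ˢ univ) (t, x) :=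
    ((hG.differentiableOn (by simp)) (t, x) ⟨ht, mem_univ x⟩).hasFDerivWithinAt
  have h2 : HasFDerivWithinAt (fun y : E d => (t, y)) (ContinuousLinearMap.inr ℝ ℝ (E d)) univ x :=
    (hasFDerivAt_prodMk_right t x).hasFDerivWithinAt
  have h3 := h1.comp x h2 fun y _ => ⟨ht, mem_univ y⟩
  exact (hasFDerivWithinAt_univ.1 h3).fderiv

lemma contDiffOn_fderiv_slice {T : ℝ} (hT : 0 < T) {G : ℝ → E d → W}
    (hG : ContDiffOn ℝ (⊤ : ℕ∞) (fun z : ℝ × E d => G z.1 z.2) (Icc 0 T ×ˢ univ)) :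
    ContDiffOn ℝ (⊤ : ℕ∞) (fun z : ℝ × E d => fderiv ℝ (G z.1) z.2) (Icc 0 T ×ˢ univ) := by
  have hS : UniqueDiffOn ℝ (Icc 0 T ×ˢ (univ : Set (E d))) :=
    (uniqueDiffOn_Icc hT).prod uniqueDiffOn_univ
  have h1 := hG.fderivWithin hS (m := (⊤ : ℕ∞)) (by simp)
  have h2 := h1.clm_comp (contDiffOn_const (c := ContinuousLinearMap.inr ℝ ℝ (E d)))
  refine h2.congr fun z hz => ?_
  exact fderiv_slice_eq hG hz.1 z.2

/-- Uniform bounds for smooth spatially periodic functions on a compact time interval. -/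
lemma exists_uniform_bounds {T : ℝ} (hT : 0 < T) {G : ℝ → E d → W}
    (hG : ContDiffOn ℝ (⊤ : ℕ∞) (fun z : ℝ × E d => G z.1 z.2) (Icc 0 T ×ˢ univ))
    (hper : ∀ t ∈ Icc 0 T, IsPeriodic (G t)) :
    ∃ K : ℝ, 0 ≤ K ∧ ∀ t ∈ Icc 0 T, (∀ x, ‖G t x‖ ≤ K) ∧
      (∀ s ∈ Icc 0 T, ∀ x, ‖G t x - G s x‖ ≤ K * |t - s|) ∧
      (∀ x y, ‖G t x - G t y‖ ≤ K * ‖x - y‖) := by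
  set S : Set (ℝ × E d) := Icc 0 T ×ˢ univ with hSdef
  set F : ℝ × E d → W := fun z => G z.1 z.2 with hF
  have hS : UniqueDiffOn ℝ S := (uniqueDiffOn_Icc hT).prod uniqueDiffOn_univ
  -- A compact convex set over the whole period cell: compactness bounds the derivatives, convexity
  -- allows the mean value inequality.
  set Q : Set (ℝ × E d) := Icc 0 T ×ˢ Metric.closedBall 0 d with hQ
  have hQS : Q ⊆ S := prod_mono subset_rfl (subset_univ _)
  have hQc : IsCompact Q := isCompact_Icc.prod (isCompact_closedBall _ _)
  have hQconv : Convex ℝ Q := (convex_Icc _ _).prod (convex_closedBall _ _)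
  obtain ⟨A, hA⟩ := hQc.exists_bound_of_continuousOn (hG.continuousOn.mono hQS)
  obtain ⟨B, hB⟩ := hQc.exists_bound_of_continuousOn
    ((hG.continuousOn_fderivWithin hS (by simp)).mono hQS)
  obtain ⟨B', hB'⟩ := hQc.exists_bound_of_continuousOn
    ((contDiffOn_fderiv_slice hT hG).continuousOn.mono hQS)
  have hcell : ∀ x ∈ cell d, x ∈ Metric.closedBall (0 : E d) d := fun x hx => by
    simpa using norm_le_of_mem_cell hx
  refine ⟨max (max A B) (max B' 0), by simp, fun t ht => ⟨?_, ?_, ?_⟩⟩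
  · refine ((hper t ht).comp fun y => ‖y‖ ≤ _).forall_of_cell fun x hx => ?_
    exact (hA (t, x) ⟨ht, hcell x hx⟩).trans (by simp)
  · intro s hs
    have hp : IsPeriodic fun x => ‖G t x - G s x‖ ≤ max (max A B) (max B' 0) * |t - s| := by
      intro i x
      simp only [hper t ht i x, hper s hs i x]
    refine hp.forall_of_cell fun x hx => ?_
    have hd : ∀ z ∈ Q, HasFDerivWithinAt F (fderivWithin ℝ F S z) Q z := fun z hz =>
      (((hG.differentiableOn (by simp)) z (hQS hz)).hasFDerivWithinAt).mono hQS
    have h1 := hQconv.norm_image_sub_le_of_norm_hasFDerivWithin_le hd hB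
      (x := (s, x)) (y := (t, x)) ⟨hs, hcell x hx⟩ ⟨ht, hcell x hx⟩
    refine h1.trans ?_
    have h2 : ‖((t, x) : ℝ × E d) - (s, x)‖ = |t - s| := by simp [Prod.norm_def]
    rw [h2]
    gcongr
    simp
  · intro x y
    have hd : ∀ z, ‖fderiv ℝ (G t) z‖ ≤ max (max A B) (max B' 0) := by
      refine ((hper t ht).fderiv.comp fun y => ‖y‖ ≤ _).forall_of_cell fun x hx => ?_
      exact (hB' (t, x) ⟨ht, hcell x hx⟩).trans (by simp)
    exact convex_univ.norm_image_sub_le_of_norm_fderiv_le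
      (fun z _ => ((contDiff_slice hG ht).differentiable (by simp)) z)
      (fun z _ => hd z) (mem_univ y) (mem_univ x)

end Slices

/-! ### The Euler scheme: almost preservation of measure and separation of trajectories -/

/-- The derivative of the determinant at the identity is the trace, so for trace-free A the
deviation from 1 is o(‖A‖). This is how incompressibility enters. -/
lemma exists_det_one_add_ge (d : ℕ) {ε : ℝ} (hε : 0 < ε) : ∃ δ : ℝ, 0 < δ ∧
    ∀ A : E d →L[ℝ] E d, ‖A‖ ≤ δ → ∑ i, (A (EuclideanSpace.single i 1)) i = 0 →
      1 - ε * ‖A‖ ≤ (ContinuousLinearMap.id ℝ (E d) + A).det := by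
  set M : (E d →L[ℝ] E d) → Matrix (Fin d) (Fin d) ℝ :=
    fun A => LinearMap.toMatrix (stdBasis d) (stdBasis d) A with hM
  have hMentry : ∀ A i j, M A i j = (A (EuclideanSpace.single j 1)) i := by
    intro A i j
    simp [hM, LinearMap.toMatrix_apply, stdBasis_apply]
    simp [stdBasis]
  set D : (E d →L[ℝ] E d) → ℝ := fun A => (1 + M A).det with hD
  have hdet : ∀ A, (ContinuousLinearMap.id ℝ (E d) + A).det = D A := by
    intro A
    rw [ContinuousLinearMap.det, ← LinearMap.det_toMatrix (stdBasis d)]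
    simp [hD, hM]
  have hdiff : DifferentiableAt ℝ D 0 := by
    simp only [hD, Matrix.det_apply, Matrix.add_apply, hMentry]
    fun_prop
  have hder : ∀ A, (∑ i, (A (EuclideanSpace.single i 1)) i = 0) → fderiv ℝ D 0 A = 0 := by
    intro A hA
    have htr : (M A).trace = 0 := by simpa [Matrix.trace, hMentry] using hA
    have h1 : HasDerivAt (fun s : ℝ => D (s • A)) (fderiv ℝ D 0 A) 0 := by
      have h2 : HasDerivAt (fun s : ℝ => s • A) A 0 := by
        simpa using (hasDerivAt_id (0 : ℝ)).smul_const A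
      have h3 : HasFDerivAt D (fderiv ℝ D 0) ((0 : ℝ) • A) := by
        rw [show (0 : ℝ) • A = 0 from zero_smul ℝ A]; exact hdiff.hasFDerivAt
      exact h3.comp_hasDerivAt 0 h2
    -- Along a line the determinant is a polynomial in s whose linear coefficient is the trace.
    have h4 : (fun s : ℝ => D (s • A)) = fun s => 1 + (M A).trace * s +
        ((1 + (Polynomial.X : Polynomial ℝ) • (M A).map Polynomial.C).det.divX.divX).eval s
          * s ^ 2 := by
      funext s
      have : M (s • A) = s • M A := by simp [hM]
      simp only [hD, this]
      exact Matrix.det_one_add_smul s (M A)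
    rw [h4, htr] at h1
    have h5 := ((Polynomial.hasDerivAt
      ((1 + (Polynomial.X : Polynomial ℝ) • (M A).map Polynomial.C).det.divX.divX) (0 : ℝ)).mul
      ((hasDerivAt_id (0 : ℝ)).pow 2)).const_add (1 + 0 * 0)
    refine h1.unique ?_
    convert h5 using 1
    · funext s; simp
    · simp
  have hlittle := hdiff.hasFDerivAt.isLittleO.def hε
  obtain ⟨δ, hδ, hball⟩ := Metric.eventually_nhds_iff.1 hlittle
  refine ⟨δ / 2, by positivity, fun A hA htr => ?_⟩
  have h := hball (y := A) (by rw [dist_zero_right]; linarith)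
  have hD0 : D 0 = 1 := by simp [hD, hM]
  rw [sub_zero, hder A htr, hD0, sub_zero, Real.norm_eq_abs] at h
  rw [hdet]
  linarith [(abs_le.1 h).1]

/-- One explicit Euler step of size `h` along the vector field `v`. -/
def eulerStep (h : ℝ) (v : E d → E d) (x : E d) : E d := x + h • v x

/-- `Φ` commutes with lattice translations. -/
def IsEquivariant (Φ : E d → E d) : Prop :=
  ∀ (i : Fin d) (x : E d), Φ (x + EuclideanSpace.single i 1) = Φ x + EuclideanSpace.single i 1

lemma IsEquivariant.add_lattice {Φ : E d → E d} (hΦ : IsEquivariant Φ) {w : E d}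
    (hw : w ∈ lattice d) (x : E d) : Φ (x + w) = Φ x + w := by
  have hp : IsPeriodic fun x => Φ x - x := by
    intro i x
    simp only [hΦ i x]
    abel
  have := hp.add_lattice hw x
  rw [sub_eq_sub_iff_add_eq_add] at this
  have h2 : Φ (x + w) + x = (Φ x + w) + x := by rw [this]; abel
  exact add_right_cancel h2

lemma IsPeriodic.comp_equivariant {α : Type*} {f : E d → α} (hf : IsPeriodic f) {Φ : E d → E d}
    (hΦ : IsEquivariant Φ) : IsPeriodic (fun x => f (Φ x)) := by
  intro i x
  simp only [hΦ i x, hf i]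

lemma IsEquivariant.eulerStep {v : E d → E d} (hv : IsPeriodic v) (h : ℝ) :
    IsEquivariant (eulerStep h v) := by
  intro i x
  simp only [Mixing.eulerStep, hv i x]
  abel

/-- The step perturbs the identity by a map with Lipschitz constant h * K < 1. -/
lemma eulerStep_injective {v : E d → E d} {h K : ℝ} (hh : 0 ≤ h)
    (hK : ∀ x y, ‖v x - v y‖ ≤ K * ‖x - y‖) (hhK : h * K < 1) :
    Function.Injective (eulerStep h v) := by
  intro x y hxy
  by_contra hne
  have hpos : 0 < ‖x - y‖ := norm_pos_iff.2 (sub_ne_zero.2 hne)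
  have h1 : x - y = h • (v y - v x) := by
    simp only [eulerStep] at hxy
    rw [smul_sub, sub_eq_sub_iff_add_eq_add, hxy, add_comm]
  have h2 : ‖x - y‖ ≤ h * (K * ‖x - y‖) := by
    calc ‖x - y‖ = h * ‖v x - v y‖ := by
          conv_lhs => rw [h1, norm_smul, Real.norm_eq_abs, abs_of_nonneg hh, norm_sub_rev]
      _ ≤ _ := by gcongr; exact hK x y
  nlinarith

/-- An Euler step increases integrals of nonnegative functions at most by the inverse of a lower
bound for its Jacobian. -/
lemma lintegral_comp_eulerStep_le {v : E d → E d} (hv : Differentiable ℝ v) (hper : IsPeriodic v)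
    {h K c : ℝ} (hh : 0 ≤ h) (hK : ∀ x y, ‖v x - v y‖ ≤ K * ‖x - y‖) (hhK : h * K < 1)
    (hc : ∀ x, c ≤ (ContinuousLinearMap.id ℝ (E d) + h • fderiv ℝ v x).det)
    {f : E d → ℝ≥0∞} (hf : IsPeriodic f) :
    ENNReal.ofReal c * ∫⁻ x, f (eulerStep h v x) ∂(cellMeasure d) ≤
      ∫⁻ x, f x ∂(cellMeasure d) := by
  have hinj := eulerStep_injective hh hK hhK
  have hder : ∀ x ∈ cell d, HasFDerivWithinAt (eulerStep h v)
      (ContinuousLinearMap.id ℝ (E d) + h • fderiv ℝ v x) (cell d) x := fun x _ =>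
    ((hasFDerivAt_id x).add ((hv x).hasFDerivAt.const_smul h)).hasFDerivWithinAt
  calc ENNReal.ofReal c * ∫⁻ x, f (eulerStep h v x) ∂(cellMeasure d)
      = ∫⁻ x in cell d, ENNReal.ofReal c * f (eulerStep h v x) :=
        (lintegral_const_mul' _ _ ENNReal.ofReal_ne_top).symm
    _ ≤ ∫⁻ x in cell d, ENNReal.ofReal |(ContinuousLinearMap.id ℝ (E d) + h • fderiv ℝ v x).det| *
          f (eulerStep h v x) := by
        refine lintegral_mono fun x => ?_
        gcongr
        exact (hc x).trans (le_abs_self _)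
    _ = ∫⁻ x in eulerStep h v '' cell d, f x :=
        (lintegral_image_eq_lintegral_abs_det_fderiv_mul volume measurableSet_cell hder
          hinj.injOn f).symm
    _ ≤ _ := by
        refine setLIntegral_le_of_injOn_orbits hf
          (measurable_image_of_fderivWithin measurableSet_cell hder hinj.injOn) ?_
        -- If the images of two points of the cell differ by a lattice vector, equivariance and
        -- injectivity make the points themselves differ by it, so it vanishes. Surjectivity of the
        -- step is not needed.
        rintro _ ⟨x, hx, rfl⟩ w hw ⟨y, hy, hxy⟩
        rw [← (IsEquivariant.eulerStep hper h).add_lattice hw] at hxy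
        have := hinj hxy
        subst this
        rw [cell_eq, ← ZSpan.fract_eq_self] at hx hy
        rw [ZSpan.fract_add_ZSpan _ _ hw, hx] at hy
        simpa using hy.symm

/-- The composition of the first `k` Euler steps. -/
def eulerFlow (h : ℝ) (v : ℕ → E d → E d) : ℕ → E d → E d
  | 0 => id
  | k + 1 => fun x => eulerStep h (v k) (eulerFlow h v k x)

lemma IsEquivariant.eulerFlow {h : ℝ} {v : ℕ → E d → E d} {n : ℕ}
    (hv : ∀ k < n, IsPeriodic (v k)) : ∀ k ≤ n, IsEquivariant (eulerFlow h v k) := by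
  intro k
  induction k with
  | zero => intro _ i x; rfl
  | succ k ih =>
    intro hk i x
    simp only [Mixing.eulerFlow, ih (by omega) i x]
    exact IsEquivariant.eulerStep (hv k (by omega)) h i _

lemma continuous_eulerFlow {h : ℝ} {v : ℕ → E d → E d} {n : ℕ}
    (hv : ∀ k < n, Continuous (v k)) : ∀ k ≤ n, Continuous (eulerFlow h v k) := by
  intro k
  induction k with
  | zero => intro _; exact continuous_id
  | succ k ih =>
    intro hk
    have h1 := ih (by omega)
    have h2 := hv k (by omega)
    exact h1.add ((h2.comp h1).const_smul h)

/-- The last step is absorbed into f, which stays periodic, so the bounds of the single steps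
multiply. -/
lemma lintegral_comp_eulerFlow_le {h J : ℝ} {v : ℕ → E d → E d} {n : ℕ} (hJ : 0 ≤ J)
    (hv : ∀ k < n, IsPeriodic (v k))
    (hstep : ∀ k < n, ∀ f : E d → ℝ≥0∞, IsPeriodic f →
      ∫⁻ x, f (eulerStep h (v k) x) ∂(cellMeasure d) ≤
        ENNReal.ofReal J * ∫⁻ x, f x ∂(cellMeasure d))
    (k : ℕ) (hk : k ≤ n) (f : E d → ℝ≥0∞) (hf : IsPeriodic f) :
    ∫⁻ x, f (eulerFlow h v k x) ∂(cellMeasure d) ≤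
      ENNReal.ofReal (J ^ k) * ∫⁻ x, f x ∂(cellMeasure d) := by
  induction k generalizing f with
  | zero => simp [eulerFlow]
  | succ k ih =>
    have h1 := ih (by omega) (fun x => f (eulerStep h (v k) x))
      (hf.comp_equivariant (IsEquivariant.eulerStep (hv k (by omega)) h))
    refine h1.trans ?_
    rw [pow_succ, ENNReal.ofReal_mul (by positivity), mul_assoc]
    gcongr
    exact hstep k (by omega) f hf

/-- Two trajectories of the Euler scheme separate at a rate that is bounded from below in terms of
the pointwise Lipschitz bounds `m k`. -/
lemma norm_sub_le_eulerFlow {h K : ℝ} {v : ℕ → E d → E d} {m : ℕ → E d → ℝ} {n : ℕ} (hh : 0 ≤ h)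
    (hK : ∀ k < n, ∀ x y, ‖v k x - v k y‖ ≤ K * ‖x - y‖) (hhK : h * K ≤ 1 / 2)
    (hm : ∀ k < n, ∀ x y, ‖v k x - v k y‖ ≤ ‖x - y‖ * (m k x + m k y)) (x y : E d) (k : ℕ)
    (hk : k ≤ n) :
    ‖x - y‖ ≤ Real.exp ((∑ j ∈ Finset.range k, 2 * h * m j (eulerFlow h v j x)) +
      ∑ j ∈ Finset.range k, 2 * h * m j (eulerFlow h v j y)) *
        ‖eulerFlow h v k x - eulerFlow h v k y‖ := by
  induction k with
  | zero => simp [eulerFlow]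
  | succ k ih =>
    set a := eulerFlow h v k x with ha
    set b := eulerFlow h v k y with hb
    have hstep : ‖a - b‖ ≤ Real.exp (2 * h * m k a + 2 * h * m k b) *
        ‖eulerStep h (v k) a - eulerStep h (v k) b‖ := by
      have h1 : ‖a - b‖ - h * ‖v k a - v k b‖ ≤
          ‖eulerStep h (v k) a - eulerStep h (v k) b‖ := by
        have : eulerStep h (v k) a - eulerStep h (v k) b = (a - b) - h • (v k b - v k a) := by
          simp only [eulerStep, smul_sub]; abel
        rw [this]
        refine le_trans ?_ (norm_sub_norm_le _ _)
        rw [norm_smul, Real.norm_eq_abs, abs_of_nonneg hh, norm_sub_rev (v k b)]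
      rcases eq_or_ne a b with hab | hab
      · rw [hab]; simp
      have hpos : 0 < ‖a - b‖ := norm_pos_iff.2 (sub_ne_zero.2 hab)
      -- The relative change of the distance in one step: the new distance is at least (1 - q) times
      -- the old one.
      set q := h * ‖v k a - v k b‖ / ‖a - b‖ with hq
      have hq0 : 0 ≤ q := by positivity
      have hqh : q ≤ 1 / 2 := by
        rw [hq, div_le_iff₀ hpos]
        have := mul_le_mul_of_nonneg_left (hK k (by omega) a b) hh
        nlinarith
      have hqm : 2 * q ≤ 2 * h * m k a + 2 * h * m k b := by
        have : q ≤ h * (m k a + m k b) := by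
          rw [hq, div_le_iff₀ hpos]
          have := mul_le_mul_of_nonneg_left (hm k (by omega) a b) hh
          nlinarith
        linarith
      -- For 0 ≤ q ≤ 1 / 2, (1 + 2q)(1 - q) = 1 + q (1 - 2q) ≥ 1. This is the source of the factor 2
      -- in front of h * m.
      have hexp : 1 ≤ Real.exp (2 * q) * (1 - q) := by
        have := Real.add_one_le_exp (2 * q)
        nlinarith
      have h2 : ‖a - b‖ - h * ‖v k a - v k b‖ = (1 - q) * ‖a - b‖ := by
        rw [hq]; field_simp
      calc ‖a - b‖ ≤ Real.exp (2 * q) * (1 - q) * ‖a - b‖ := le_mul_of_one_le_left hpos.le hexp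
        _ = Real.exp (2 * q) * (‖a - b‖ - h * ‖v k a - v k b‖) := by rw [h2]; ring
        _ ≤ Real.exp (2 * h * m k a + 2 * h * m k b) *
            ‖eulerStep h (v k) a - eulerStep h (v k) b‖ := by
          refine mul_le_mul (Real.exp_le_exp.2 hqm) h1 ?_ (Real.exp_pos _).le
          rw [h2]
          exact mul_nonneg (by linarith) hpos.le
    refine (ih (by omega)).trans ?_
    rw [Finset.sum_range_succ, Finset.sum_range_succ, ← ha, ← hb]
    calc _ ≤ _ := mul_le_mul_of_nonneg_left hstep (Real.exp_pos _).le
      _ = _ := by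
        rw [← mul_assoc, ← Real.exp_add]
        congr 2
        ring

/-! ### Mollification -/

/-- `k` is a smooth probability density supported in the ball of radius `r`. -/
structure IsKernel (k : E d → ℝ) (r : ℝ) : Prop where
  smooth : ContDiff ℝ (⊤ : ℕ∞) k
  nonneg : ∀ z, 0 ≤ k z
  integral_eq : ∫ z, k z = 1
  norm_le : ∀ z, k z ≠ 0 → ‖z‖ ≤ r

/-- The convolution of `f` with the kernel `k`. -/
def mollify (k f : E d → ℝ) (x : E d) : ℝ := ∫ z, k z * f (x - z)

namespace IsKernel

variable {k f : E d → ℝ} {r : ℝ}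

lemma hasCompactSupport (hk : IsKernel k r) : HasCompactSupport k :=
  HasCompactSupport.intro (isCompact_closedBall 0 r) fun z hz => by
    by_contra h
    exact hz (by simpa using hk.norm_le z h)

lemma integrable (hk : IsKernel k r) : Integrable k :=
  hk.smooth.continuous.integrable_of_hasCompactSupport hk.hasCompactSupport

lemma integrable_mul (hk : IsKernel k r) {g : E d → ℝ} (hg : Measurable g) {B : ℝ}
    (hB : ∀ x, |g x| ≤ B) : Integrable fun z => k z * g z :=
  hk.integrable.mul_bdd hg.aestronglyMeasurable (Filter.Eventually.of_forall hB)

lemma integrable_mollify (hk : IsKernel k r) (hf : Measurable f) {B : ℝ}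
    (hB : ∀ x, |f x| ≤ B) (x : E d) : Integrable fun z => k z * f (x - z) :=
  hk.integrable_mul (hf.comp (measurable_const.sub measurable_id)) fun z => hB (x - z)

lemma contDiff_mollify (hk : IsKernel k r) (hf : Measurable f) {B : ℝ} (hB : ∀ x, |f x| ≤ B) :
    ContDiff ℝ (⊤ : ℕ∞) (mollify k f) := by
  have hloc : LocallyIntegrable f := by
    refine (locallyIntegrable_const B).mono hf.aestronglyMeasurable ?_
    exact Filter.Eventually.of_forall fun x => (hB x).trans (le_abs_self B)
  exact hk.hasCompactSupport.contDiff_convolution_left (ContinuousLinearMap.lsmul ℝ ℝ) hk.smooth hloc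

lemma abs_integral_mul_le (hk : IsKernel k r) {g : E d → ℝ} {B : ℝ}
    (hB : ∀ z, ‖z‖ ≤ r → |g z| ≤ B) : |∫ z, k z * g z| ≤ B := by
  have h1 : ‖∫ z, k z * g z‖ ≤ ∫ z, k z * B := by
    refine norm_integral_le_of_norm_le (hk.integrable.mul_const B)
      (Filter.Eventually.of_forall fun z => ?_)
    rw [Real.norm_eq_abs, abs_mul, abs_of_nonneg (hk.nonneg z)]
    by_cases hz : k z = 0
    · simp [hz]
    · exact mul_le_mul_of_nonneg_left (hB z (hk.norm_le z hz)) (hk.nonneg z)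
  rwa [integral_mul_const, hk.integral_eq, one_mul] at h1

lemma abs_mollify_le (hk : IsKernel k r) {B : ℝ} (hB : ∀ x, |f x| ≤ B) (x : E d) :
    |mollify k f x| ≤ B :=
  hk.abs_integral_mul_le fun z _ => hB (x - z)

lemma abs_mollify_sub_le (hk : IsKernel k r) (hf : Measurable f) {B : ℝ}
    (hB : ∀ x, |f x| ≤ B) {L : ℝ} (hL0 : 0 ≤ L) (hL : ∀ x y, |f x - f y| ≤ L * ‖x - y‖) (x : E d) :
    |mollify k f x - f x| ≤ L * r := by
  have h1 : mollify k f x - f x = ∫ z, k z * (f (x - z) - f x) := by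
    simp_rw [mul_sub]
    rw [integral_sub (hk.integrable_mollify hf hB x) (hk.integrable.mul_const _),
      integral_mul_const, hk.integral_eq, one_mul, mollify]
  rw [h1]
  refine hk.abs_integral_mul_le fun z hz => (hL _ _).trans ?_
  have : ‖x - z - x‖ = ‖z‖ := by rw [sub_sub_cancel_left, norm_neg]
  rw [this]
  gcongr

lemma abs_mollify_sub_mollify_le (hk : IsKernel k r) (hf : Measurable f) {B : ℝ}
    (hB : ∀ x, |f x| ≤ B) {L : ℝ} (hL : ∀ x y, |f x - f y| ≤ L * ‖x - y‖) (x y : E d) :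
    |mollify k f x - mollify k f y| ≤ L * ‖x - y‖ := by
  have h1 : mollify k f x - mollify k f y = ∫ z, k z * (f (x - z) - f (y - z)) := by
    simp_rw [mul_sub]
    rw [integral_sub (hk.integrable_mollify hf hB x) (hk.integrable_mollify hf hB y)]
    rfl
  rw [h1]
  refine hk.abs_integral_mul_le fun z hz => (hL _ _).trans ?_
  rw [sub_sub_sub_cancel_right]

/-- Mollification of a bounded function is Lipschitz, with the constant determined by the
`L¹` modulus of continuity of the kernel. -/
lemma abs_mollify_sub_mollify_le_of_bounded (hk : IsKernel k r) (hf : Measurable f) {B : ℝ}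
    (hB : ∀ x, |f x| ≤ B) {l : ℝ} (hl : ∀ a, ∫ z, |k (z + a) - k z| ≤ l * ‖a‖) (x y : E d) :
    |mollify k f x - mollify k f y| ≤ B * l * ‖x - y‖ := by
  have hB0 : 0 ≤ B := (abs_nonneg _).trans (hB 0)
  have hka : Integrable fun z => k (z + (x - y)) := hk.integrable.comp_add_right (x - y)
  have hmeas : Measurable fun z => f (y - z) := hf.comp (measurable_const.sub measurable_id)
  have h1 : mollify k f x = ∫ z, k (z + (x - y)) * f (y - z) := by
    rw [mollify, ← integral_add_right_eq_self _ (x - y)]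
    refine integral_congr_ae (Filter.Eventually.of_forall fun z => ?_)
    have : x - (z + (x - y)) = y - z := by abel
    simp only [this]
  have h2 : mollify k f x - mollify k f y = ∫ z, (k (z + (x - y)) - k z) * f (y - z) := by
    simp_rw [sub_mul]
    rw [integral_sub (hka.mul_bdd hmeas.aestronglyMeasurable
      (Filter.Eventually.of_forall fun z => hB (y - z))) (hk.integrable_mollify hf hB y), h1]
    rfl
  have h3 : ‖∫ z, (k (z + (x - y)) - k z) * f (y - z)‖ ≤ ∫ z, |k (z + (x - y)) - k z| * B := by
    refine norm_integral_le_of_norm_le ((hka.sub hk.integrable).abs.mul_const B)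
      (Filter.Eventually.of_forall fun z => ?_)
    rw [Real.norm_eq_abs, abs_mul]
    exact mul_le_mul_of_nonneg_left (hB _) (abs_nonneg _)
  rw [h2, ← Real.norm_eq_abs]
  refine h3.trans ?_
  rw [integral_mul_const, mul_comm, mul_assoc]
  exact mul_le_mul_of_nonneg_left (hl _) hB0

/-- Mollification of a Lipschitz function has a Lipschitz gradient. -/
lemma norm_fderiv_mollify_sub_le (hk : IsKernel k r) (hf : Measurable f) {B : ℝ}
    (hB : ∀ x, |f x| ≤ B) {L : ℝ} (hL0 : 0 ≤ L) (hL : ∀ x y, |f x - f y| ≤ L * ‖x - y‖)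
    {l : ℝ} (hl0 : 0 ≤ l) (hl : ∀ a, ∫ z, |k (z + a) - k z| ≤ l * ‖a‖) (x y : E d) :
    ‖fderiv ℝ (mollify k f) x - fderiv ℝ (mollify k f) y‖ ≤ L * l * ‖x - y‖ := by
  have hdiff : Differentiable ℝ (mollify k f) := (hk.contDiff_mollify hf hB).differentiable (by simp)
  refine ContinuousLinearMap.opNorm_le_bound _ (by positivity) fun v => ?_
  -- As f is merely Lipschitz, difference quotients replace its derivative: they commute with
  -- mollification, are bounded by L * ‖v‖, and the estimate for bounded functions survives in the
  -- limit.
  have hline : ∀ x : E d, Filter.Tendsto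
      (fun t : ℝ => t⁻¹ * (mollify k f (x + t • v) - mollify k f x)) (nhdsWithin 0 (Ioi 0))
      (nhds (fderiv ℝ (mollify k f) x v)) := by
    intro x
    have h1 : HasDerivAt (fun t : ℝ => mollify k f (x + t • v)) (fderiv ℝ (mollify k f) x v) 0 := by
      have h2 : HasDerivAt (fun t : ℝ => x + t • v) v 0 := by
        simpa using ((hasDerivAt_id (0 : ℝ)).smul_const v).const_add x
      have h3 : HasFDerivAt (mollify k f) (fderiv ℝ (mollify k f) x) (x + (0 : ℝ) • v) := by
        simpa using (hdiff x).hasFDerivAt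
      exact h3.comp_hasDerivAt 0 h2
    have h4 := h1.tendsto_slope_zero_right
    simpa using h4
  have hlim := ((hline x).sub (hline y)).norm
  rw [sub_apply]
  refine le_of_tendsto hlim ?_
  filter_upwards [self_mem_nhdsWithin] with t ht
  have ht0 : (0 : ℝ) < t := ht
  set g : E d → ℝ := fun x => t⁻¹ * (f (x + t • v) - f x) with hg
  have hgm : Measurable g := ((hf.comp (measurable_id.add_const _)).sub hf).const_mul _
  have hgB : ∀ x, |g x| ≤ L * ‖v‖ := by
    intro x
    rw [hg, abs_mul, abs_of_pos (inv_pos.2 ht0), inv_mul_le_iff₀ ht0]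
    refine (hL _ _).trans (le_of_eq ?_)
    rw [add_sub_cancel_left, norm_smul, Real.norm_eq_abs, abs_of_pos ht0]
    ring
  have hmg : ∀ x, t⁻¹ * (mollify k f (x + t • v) - mollify k f x) = mollify k g x := by
    intro x
    simp only [mollify]
    rw [← integral_sub (hk.integrable_mollify hf hB _) (hk.integrable_mollify hf hB _),
      ← integral_const_mul]
    refine integral_congr_ae (Filter.Eventually.of_forall fun z => ?_)
    simp only [hg, sub_add_eq_add_sub]
    ring
  rw [hmg x, hmg y, Real.norm_eq_abs]
  refine (hk.abs_mollify_sub_mollify_le_of_bounded hgm hgB hl x y).trans (le_of_eq ?_)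
  ring

end IsKernel

lemma IsPeriodic.mollify {f : E d → ℝ} (hf : IsPeriodic f) (k : E d → ℝ) :
    IsPeriodic (mollify k f) := by
  intro i x
  simp only [Mixing.mollify]
  refine integral_congr_ae (Filter.Eventually.of_forall fun z => ?_)
  simp only [add_sub_right_comm, hf i]

/-- Kernels of every radius `r` with `L¹` modulus of continuity proportional to `1 / r`. -/
lemma exists_isKernel (d : ℕ) : ∃ C : ℝ, 0 < C ∧ ∀ r : ℝ, 0 < r → ∃ k : E d → ℝ, IsKernel k r ∧
    ∀ a, ∫ z, |k (z + a) - k z| ≤ C / r * ‖a‖ := by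
  let b : ContDiffBump (0 : E d) := ⟨1 / 2, 1, by norm_num, by norm_num⟩
  set φ : E d → ℝ := b.normed volume with hφ
  have hφs : ContDiff ℝ (⊤ : ℕ∞) φ := b.contDiff_normed
  have hφc : HasCompactSupport φ := b.hasCompactSupport_normed
  have hφ1 : ∀ z, φ z ≠ 0 → ‖z‖ ≤ 1 := by
    intro z hz
    have : z ∈ Function.support φ := hz
    rw [hφ, b.support_normed_eq] at this
    simpa using (Metric.mem_ball.1 this).le
  have hφint : Integrable φ := b.integrable_normed
  obtain ⟨D, hD⟩ := (hφs.continuous_fderiv (by simp)).bounded_above_of_compact_support (hφc.fderiv ℝ)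
  have hD0 : 0 ≤ D := (norm_nonneg _).trans (hD 0)
  have hlip : ∀ x y, |φ x - φ y| ≤ D * ‖x - y‖ := fun x y =>
    convex_univ.norm_image_sub_le_of_norm_fderiv_le
      (fun z _ => (hφs.differentiable (by simp)) z) (fun z _ => hD z) (mem_univ y) (mem_univ x)
  set V : ℝ := volume.real (Metric.closedBall (0 : E d) 1) with hV
  have hmod : ∀ a, ∫ z, |φ (z + a) - φ z| ≤ (2 * D * V) * ‖a‖ := by
    intro a
    set χ : E d → ℝ := (Metric.closedBall (0 : E d) 1).indicator fun _ => 1 with hχ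
    have hχi : Integrable χ := by
      rw [hχ, integrable_indicator_iff measurableSet_closedBall]
      exact integrableOn_const measure_closedBall_lt_top.ne
    have hχI : ∫ z, χ z = V := by
      rw [hχ, integral_indicator measurableSet_closedBall]; simp [hV]
    -- The difference vanishes unless z or z + a lies in the unit ball; the two indicators have
    -- total integral 2 * V.
    have hpt : ∀ z, |φ (z + a) - φ z| ≤ D * ‖a‖ * (χ (z + a) + χ z) := by
      intro z
      have hχ0 : ∀ w, 0 ≤ χ w := fun w => indicator_nonneg (fun _ _ => zero_le_one) w
      have hχ1 : ∀ w, φ w ≠ 0 → χ w = 1 := fun w hw => by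
        rw [hχ, indicator_of_mem (by simpa using hφ1 w hw)]
      by_cases h1 : φ z = 0 ∧ φ (z + a) = 0
      · rw [h1.1, h1.2]
        simpa using mul_nonneg (mul_nonneg hD0 (norm_nonneg a)) (add_nonneg (hχ0 _) (hχ0 _))
      · have h2 : 1 ≤ χ (z + a) + χ z := by
          by_cases hz : φ z = 0
          · rw [hχ1 (z + a) fun h => h1 ⟨hz, h⟩]; linarith [hχ0 z]
          · rw [hχ1 z hz]; linarith [hχ0 (z + a)]
        calc _ ≤ D * ‖a‖ := by simpa using hlip (z + a) z
          _ ≤ _ := le_mul_of_one_le_right (by positivity) h2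
    have hχa : Integrable fun z => χ (z + a) := hχi.comp_add_right a
    calc _ ≤ ∫ z, D * ‖a‖ * (χ (z + a) + χ z) :=
          integral_mono ((hφint.comp_add_right a).sub hφint).abs
            ((hχa.add hχi).const_mul _) hpt
      _ = _ := by
          rw [integral_const_mul, integral_add hχa hχi, integral_add_right_eq_self χ a, hχI]
          ring
  refine ⟨2 * D * V + 1, by positivity, fun r hr => ?_⟩
  have hrd : 0 < r ^ d := by positivity
  have hscale : ∀ g : E d → ℝ, ∫ z, (r ^ d)⁻¹ * g (r⁻¹ • z) = ∫ z, g z := by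
    intro g
    rw [integral_const_mul, Measure.integral_comp_inv_smul]
    simp only [finrank_euclideanSpace, Fintype.card_fin, smul_eq_mul, abs_of_pos hrd]
    field_simp
  refine ⟨fun z => (r ^ d)⁻¹ * φ (r⁻¹ • z), ⟨?_, ?_, ?_, ?_⟩, ?_⟩
  · exact contDiff_const.mul (hφs.comp (contDiff_const_smul _))
  · exact fun z => mul_nonneg (by positivity) (b.nonneg_normed _)
  · rw [hscale]; exact b.integral_normed
  · intro z hz
    have h1 := hφ1 _ (right_ne_zero_of_mul hz)
    rwa [norm_smul, norm_inv, Real.norm_eq_abs, abs_of_pos hr, inv_mul_le_iff₀ hr, mul_one] at h1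
  · intro a
    have h1 : ∀ z, |(r ^ d)⁻¹ * φ (r⁻¹ • (z + a)) - (r ^ d)⁻¹ * φ (r⁻¹ • z)| =
        (r ^ d)⁻¹ * (fun w => |φ (w + r⁻¹ • a) - φ w|) (r⁻¹ • z) := by
      intro z
      rw [← mul_sub, abs_mul, abs_of_pos (inv_pos.2 hrd), smul_add]
    simp_rw [h1]
    refine (hscale fun w => |φ (w + r⁻¹ • a) - φ w|).le.trans ((hmod _).trans ?_)
    rw [norm_smul, norm_inv, Real.norm_eq_abs, abs_of_pos hr, ← mul_assoc, ← div_eq_mul_inv]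
    gcongr
    linarith

/-- Smooth periodic approximation of a bounded periodic function. -/
lemma exists_smooth_approx {f : E d → ℝ} (hf : Measurable f) (hper : IsPeriodic f)
    (h1 : ∀ x, |f x| ≤ 1) {ε : ℝ} (hε : 0 < ε) :
    ∃ ψ : E d → ℝ, ContDiff ℝ (⊤ : ℕ∞) ψ ∧ IsPeriodic ψ ∧ (∀ x, |ψ x| ≤ 1) ∧
      ∫ x, f x * f x ∂(cellMeasure d) - ε ≤ ∫ x, f x * ψ x ∂(cellMeasure d) := by
  -- Outer radius twice the inner one: a bounded ratio of the radii gives convergence of the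
  -- mollifications almost everywhere.
  let b : ℕ → ContDiffBump (0 : E d) := fun n =>
    ⟨1 / (2 * ((n : ℝ) + 1)), 1 / ((n : ℝ) + 1), by positivity, by
      apply one_div_lt_one_div_of_lt <;> [positivity; linarith [n.cast_nonneg (α := ℝ)]]⟩
  have hk : ∀ n, IsKernel ((b n).normed volume) (1 / ((n : ℝ) + 1)) := fun n =>
    { smooth := (b n).contDiff_normed
      nonneg := (b n).nonneg_normed
      integral_eq := (b n).integral_normed
      norm_le := fun z hz => by
        have : z ∈ Function.support ((b n).normed volume) := hz
        rw [(b n).support_normed_eq] at this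
        exact (dist_zero_right z).symm.le.trans (Metric.mem_ball.1 this).le }
  have hloc : LocallyIntegrable f := by
    refine (locallyIntegrable_const (1 : ℝ)).mono hf.aestronglyMeasurable ?_
    exact Filter.Eventually.of_forall fun x => (h1 x).trans (le_abs_self 1)
  have hconv : ∀ᵐ x, Filter.Tendsto (fun n => mollify ((b n).normed volume) f x) Filter.atTop
      (nhds (f x)) := by
    refine ContDiffBump.ae_convolution_tendsto_right_of_locallyIntegrable (K := 2) ?_ ?_ hloc
    · exact tendsto_one_div_add_atTop_nhds_zero_nat
    · refine Filter.Eventually.of_forall fun n => le_of_eq ?_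
      change 1 / ((n : ℝ) + 1) = 2 * (1 / (2 * ((n : ℝ) + 1)))
      field_simp
  have hlim : Filter.Tendsto
      (fun n => ∫ x, f x * mollify ((b n).normed volume) f x ∂(cellMeasure d)) Filter.atTop
      (nhds (∫ x, f x * f x ∂(cellMeasure d))) := by
    refine tendsto_integral_of_dominated_convergence (fun _ => 1) ?_ (integrable_const _) ?_ ?_
    · exact fun n => (hf.mul ((hk n).contDiff_mollify hf h1).continuous.measurable).aestronglyMeasurable
    · refine fun n => Filter.Eventually.of_forall fun x => ?_
      rw [Real.norm_eq_abs, abs_mul]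
      exact mul_le_one₀ (h1 x) (abs_nonneg _) ((hk n).abs_mollify_le h1 x)
    · refine ae_restrict_of_ae ?_
      filter_upwards [hconv] with x hx using hx.const_mul _
  obtain ⟨n, hn⟩ := (hlim.eventually (lt_mem_nhds (sub_lt_self _ hε))).exists
  exact ⟨_, (hk n).contDiff_mollify hf h1, hper.mollify _, (hk n).abs_mollify_le h1, hn.le⟩

/-! ### Weak solutions along the Euler scheme -/

/-- Uniform bounds for an incompressible velocity field and its gradient. -/
structure HasRegularity (T K : ℝ) (u : ℝ → E d → E d) : Prop where
  nonneg : 0 ≤ K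
  smooth : ∀ t ∈ Icc 0 T, ContDiff ℝ (⊤ : ℕ∞) (u t)
  norm_le : ∀ t ∈ Icc 0 T, ∀ x, ‖u t x‖ ≤ K
  lipschitz : ∀ t ∈ Icc 0 T, ∀ x y, ‖u t x - u t y‖ ≤ K * ‖x - y‖
  lipschitz_time : ∀ t ∈ Icc 0 T, ∀ s ∈ Icc 0 T, ∀ x, ‖u t x - u s x‖ ≤ K * |t - s|
  norm_fderiv_le : ∀ t ∈ Icc 0 T, ∀ x, ‖fderiv ℝ (u t) x‖ ≤ K
  fderiv_lipschitz : ∀ t ∈ Icc 0 T, ∀ x y, ‖fderiv ℝ (u t) x - fderiv ℝ (u t) y‖ ≤ K * ‖x - y‖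
  fderiv_lipschitz_time : ∀ t ∈ Icc 0 T, ∀ s ∈ Icc 0 T, ∀ x,
    ‖fderiv ℝ (u t) x - fderiv ℝ (u s) x‖ ≤ K * |t - s|

lemma IsIncompressibleFlow.exists_hasRegularity {T : ℝ} (hT : 0 < T) {u : ℝ → E d → E d}
    (hu : IsIncompressibleFlow T u) : ∃ K, HasRegularity T K u := by
  obtain ⟨A, hA0, hA⟩ := exists_uniform_bounds hT hu.smooth hu.periodic
  obtain ⟨B, hB0, hB⟩ := exists_uniform_bounds hT (contDiffOn_fderiv_slice hT hu.smooth)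
    fun t ht => (hu.periodic t ht).fderiv
  have hAm := le_max_left A B
  have hBm := le_max_right A B
  refine ⟨max A B, hA0.trans hAm, fun t ht => contDiff_slice hu.smooth ht,
    fun t ht x => ((hA t ht).1 x).trans hAm, fun t ht x y => ((hA t ht).2.2 x y).trans (by gcongr),
    fun t ht s hs x => ((hA t ht).2.1 s hs x).trans (by gcongr),
    fun t ht x => ((hB t ht).1 x).trans hBm, fun t ht x y => ((hB t ht).2.2 x y).trans (by gcongr),
    fun t ht s hs x => ((hB t ht).2.1 s hs x).trans (by gcongr)⟩

/-- A smooth periodic test function whose gradient is bounded and Lipschitz with constant `A`. -/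
structure IsTest (A : ℝ) (ζ : E d → ℝ) : Prop where
  smooth : ContDiff ℝ (⊤ : ℕ∞) ζ
  periodic : IsPeriodic ζ
  norm_fderiv_le : ∀ x, ‖fderiv ℝ ζ x‖ ≤ A
  fderiv_lipschitz : ∀ x y, ‖fderiv ℝ ζ x - fderiv ℝ ζ y‖ ≤ A * ‖x - y‖

lemma IsTest.nonneg {A : ℝ} {ζ : E d → ℝ} (h : IsTest A ζ) : 0 ≤ A :=
  (norm_nonneg _).trans (h.norm_fderiv_le 0)

lemma abs_integral_cell_le {f : E d → ℝ} {B : ℝ} (h : ∀ x, |f x| ≤ B) :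
    |∫ x, f x ∂(cellMeasure d)| ≤ B := by
  have := norm_integral_le_of_norm_le_const (μ := cellMeasure d)
    (Filter.Eventually.of_forall (p := fun x => ‖f x‖ ≤ B) h)
  simpa using this

/-- Pulling back by a step multiplies the constant by 1 + O(h), so it remains bounded over the T / h
steps of the scheme. -/
lemma IsTest.comp_eulerStep {A K h : ℝ} {ζ : E d → ℝ} (hζ : IsTest A ζ) {v : E d → E d}
    (hv : ContDiff ℝ (⊤ : ℕ∞) v) (hper : IsPeriodic v) (hh : 0 ≤ h) (hK0 : 0 ≤ K)
    (hhK : h * K ≤ 1) (hK : ∀ x y, ‖v x - v y‖ ≤ K * ‖x - y‖) (hD : ∀ x, ‖fderiv ℝ v x‖ ≤ K)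
    (hDL : ∀ x y, ‖fderiv ℝ v x - fderiv ℝ v y‖ ≤ K * ‖x - y‖) :
    IsTest (A * Real.exp (4 * h * K)) (fun x => ζ (eulerStep h v x)) := by
  have hA := hζ.nonneg
  have hΦ : ContDiff ℝ (⊤ : ℕ∞) (eulerStep h v) := contDiff_id.add (hv.const_smul h)
  -- With x = h * K ≤ 1 the left side is 1 + 3x + x² ≤ 1 + 4x.
  have hexp : (1 + h * K) * (1 + h * K) + h * K ≤ Real.exp (4 * h * K) := by
    have := Real.add_one_le_exp (4 * h * K)
    have hp : 0 ≤ h * K := mul_nonneg hh hK0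
    nlinarith
  have hp : 0 ≤ h * K := mul_nonneg hh hK0
  set DΦ : E d → E d →L[ℝ] E d := fun x => ContinuousLinearMap.id ℝ (E d) + h • fderiv ℝ v x
  have hder : ∀ x, fderiv ℝ (fun x => ζ (eulerStep h v x)) x =
      (fderiv ℝ ζ (eulerStep h v x)).comp (DΦ x) := by
    intro x
    have h1 : HasFDerivAt (eulerStep h v) (DΦ x) x :=
      (hasFDerivAt_id x).add (((hv.differentiable (by simp)) x).hasFDerivAt.const_smul h)
    exact (((hζ.smooth.differentiable (by simp)) _).hasFDerivAt.comp x h1).fderiv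
  have hDΦ : ∀ x, ‖DΦ x‖ ≤ 1 + h * K := by
    intro x
    refine (norm_add_le _ _).trans (add_le_add ContinuousLinearMap.norm_id_le ?_)
    rw [norm_smul, Real.norm_eq_abs, abs_of_nonneg hh]
    gcongr
    exact hD x
  have hDΦL : ∀ x y, ‖DΦ x - DΦ y‖ ≤ h * K * ‖x - y‖ := by
    intro x y
    have : DΦ x - DΦ y = h • (fderiv ℝ v x - fderiv ℝ v y) := by
      simp only [DΦ, smul_sub]; abel
    rw [this, norm_smul, Real.norm_eq_abs, abs_of_nonneg hh, mul_assoc]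
    gcongr
    exact hDL x y
  have hΦL : ∀ x y, ‖eulerStep h v x - eulerStep h v y‖ ≤ (1 + h * K) * ‖x - y‖ := by
    intro x y
    have : eulerStep h v x - eulerStep h v y = (x - y) + h • (v x - v y) := by
      simp only [eulerStep, smul_sub]; abel
    rw [this]
    refine (norm_add_le _ _).trans ?_
    rw [norm_smul, Real.norm_eq_abs, abs_of_nonneg hh, add_mul, one_mul, mul_assoc]
    gcongr
    exact hK x y
  refine ⟨hζ.smooth.comp hΦ, hζ.periodic.comp_equivariant (IsEquivariant.eulerStep hper h), ?_, ?_⟩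
  · intro x
    rw [hder]
    refine (ContinuousLinearMap.opNorm_comp_le _ _).trans ?_
    refine mul_le_mul (hζ.norm_fderiv_le _) ((hDΦ x).trans ?_) (norm_nonneg _) hA
    nlinarith
  · intro x y
    rw [hder, hder]
    have : (fderiv ℝ ζ (eulerStep h v x)).comp (DΦ x) - (fderiv ℝ ζ (eulerStep h v y)).comp (DΦ y) =
        (fderiv ℝ ζ (eulerStep h v x) - fderiv ℝ ζ (eulerStep h v y)).comp (DΦ x) +
          (fderiv ℝ ζ (eulerStep h v y)).comp (DΦ x - DΦ y) := by
      simp only [ContinuousLinearMap.sub_comp, ContinuousLinearMap.comp_sub]; abel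
    rw [this]
    calc _ ≤ _ := norm_add_le _ _
      _ ≤ (A * ((1 + h * K) * ‖x - y‖)) * (1 + h * K) + A * (h * K * ‖x - y‖) := by
          refine add_le_add ((ContinuousLinearMap.opNorm_comp_le _ _).trans ?_)
            ((ContinuousLinearMap.opNorm_comp_le _ _).trans ?_)
          · refine mul_le_mul ((hζ.fderiv_lipschitz _ _).trans ?_) (hDΦ x) (norm_nonneg _)
              (by positivity)
            exact mul_le_mul_of_nonneg_left (hΦL x y) hA
          · exact mul_le_mul (hζ.norm_fderiv_le _) (hDΦL x y) (norm_nonneg _) hA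
      _ = A * ((1 + h * K) * (1 + h * K) + h * K) * ‖x - y‖ := by ring
      _ ≤ _ := by gcongr

lemma IsTest.abs_taylor_le {A K h : ℝ} {ζ : E d → ℝ} (hζ : IsTest A ζ) {v : E d → E d}
    (hh : 0 ≤ h) (hK : ∀ x, ‖v x‖ ≤ K) (x : E d) :
    |ζ (eulerStep h v x) - ζ x - h * fderiv ℝ ζ x (v x)| ≤ A * (h * K) ^ 2 := by
  have hA := hζ.nonneg
  have hK0 : 0 ≤ K := (norm_nonneg _).trans (hK x)
  have hv : ‖h • v x‖ ≤ h * K := by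
    rw [norm_smul, Real.norm_eq_abs, abs_of_nonneg hh]
    gcongr
    exact hK x
  have h1 := (convex_closedBall x (h * K)).norm_image_sub_le_of_norm_fderiv_le' (𝕜 := ℝ) (f := ζ)
    (φ := fderiv ℝ ζ x) (C := A * (h * K)) (x := x) (y := eulerStep h v x)
    (fun z _ => (hζ.smooth.differentiable (by simp)) z)
    (fun z hz => (hζ.fderiv_lipschitz z x).trans (by
      gcongr
      simpa [dist_eq_norm] using hz))
    (Metric.mem_closedBall_self (by positivity))
    (by simpa [eulerStep, dist_eq_norm] using hv)
  have h2 : eulerStep h v x - x = h • v x := by simp [eulerStep]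
  rw [h2, map_smul, smul_eq_mul, Real.norm_eq_abs] at h1
  refine h1.trans ?_
  calc A * (h * K) * ‖h • v x‖ ≤ A * (h * K) * (h * K) := by gcongr
    _ = _ := by ring

section Weak

variable {T K : ℝ} {u : ℝ → E d → E d} {ρ₀ : E d → ℝ} {ρ : ℝ → E d → ℝ}

lemma IsTransportSolution.abs_apply_le (hρ : IsTransportSolution T u ρ₀ ρ) {t : ℝ} (ht : t ∈ Icc 0 T)
    (x : E d) : |ρ t x| ≤ 1 := by
  rcases hρ.values t ht x with h | h <;> simp [h]

lemma IsTransportSolution.measurable_slice (hρ : IsTransportSolution T u ρ₀ ρ) (t : ℝ) :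
    Measurable (ρ t) :=
  hρ.measurable.comp (measurable_const.prodMk measurable_id)

lemma IsTransportSolution.integrable_mul (hρ : IsTransportSolution T u ρ₀ ρ) {t : ℝ}
    (ht : t ∈ Icc 0 T) {f : E d → ℝ} (hf : Continuous f) {B : ℝ} (hB : ∀ x, |f x| ≤ B) :
    Integrable (fun x => ρ t x * f x) (cellMeasure d) := by
  refine Integrable.of_bound (C := B)
    ((hρ.measurable_slice t).mul hf.measurable).aestronglyMeasurable
    (Filter.Eventually.of_forall fun x => ?_)
  rw [Real.norm_eq_abs, abs_mul]
  calc _ ≤ 1 * |f x| := by gcongr; exact hρ.abs_apply_le ht x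
    _ ≤ B := by rw [one_mul]; exact hB x

lemma IsTransportSolution.abs_flux_le (hρ : IsTransportSolution T u ρ₀ ρ)
    (hu : HasRegularity T K u) {ζ : E d → ℝ} {A : ℝ} (hζ : ∀ x, ‖fderiv ℝ ζ x‖ ≤ A) {s : ℝ}
    (hs : s ∈ Icc 0 T) :
    |∫ x, ρ s x * fderiv ℝ ζ x (u s x) ∂(cellMeasure d)| ≤ A * K := by
  refine abs_integral_cell_le fun x => ?_
  have hA : 0 ≤ A := (norm_nonneg _).trans (hζ 0)
  rw [abs_mul]
  calc _ ≤ 1 * (A * K) := by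
        refine mul_le_mul (hρ.abs_apply_le hs x) ?_ (abs_nonneg _) zero_le_one
        rw [← Real.norm_eq_abs]
        refine (ContinuousLinearMap.le_opNorm _ _).trans ?_
        exact mul_le_mul (hζ x) (hu.norm_le s hs x) (norm_nonneg _) hA
    _ = _ := one_mul _

lemma IsTransportSolution.intervalIntegrable_flux (hρ : IsTransportSolution T u ρ₀ ρ)
    (hflow : IsIncompressibleFlow T u) (hu : HasRegularity T K u) {ζ : E d → ℝ}
    (hs : ContDiff ℝ (⊤ : ℕ∞) ζ) (hp : IsPeriodic ζ) {a b : ℝ} (ha : a ∈ Icc 0 T)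
    (hb : b ∈ Icc 0 T) :
    IntervalIntegrable (fun s => ∫ x, ρ s x * fderiv ℝ ζ x (u s x) ∂(cellMeasure d)) volume a b := by
  obtain ⟨A, -, hA⟩ := hp.fderiv.exists_norm_le (hs.continuous_fderiv (by simp))
  have hI : IntegrableOn (fun s => ∫ x, ρ s x * fderiv ℝ ζ x (u s x) ∂(cellMeasure d))
      (Icc 0 T) volume := by
    refine Integrable.of_bound (C := A * K) ?_ ?_
    · have hcont : ContinuousOn (fun z : ℝ × E d => fderiv ℝ ζ z.2 (u z.1 z.2))
          (Icc 0 T ×ˢ univ) :=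
        ((hs.continuous_fderiv (by simp)).comp continuous_snd).continuousOn.clm_apply
          hflow.smooth.continuousOn
      have hmeas : AEStronglyMeasurable (fun z : ℝ × E d => fderiv ℝ ζ z.2 (u z.1 z.2))
          ((volume.restrict (Icc 0 T)).prod (cellMeasure d)) := by
        have h1 := hcont.aestronglyMeasurable (μ := volume.prod (cellMeasure d))
          (measurableSet_Icc.prod MeasurableSet.univ)
        rwa [← Measure.prod_restrict, Measure.restrict_univ] at h1
      exact (hρ.measurable.aestronglyMeasurable.mul hmeas).integral_prod_right'
    · filter_upwards [ae_restrict_mem measurableSet_Icc] with s hs'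
      exact hρ.abs_flux_le hu hA hs'
  refine (hI.mono_set ?_).intervalIntegrable
  exact uIcc_subset_Icc ha hb

lemma IsTransportSolution.integral_mul_sub (hρ : IsTransportSolution T u ρ₀ ρ)
    (hflow : IsIncompressibleFlow T u) (hu : HasRegularity T K u) (hT : 0 < T) {ζ : E d → ℝ}
    (hs : ContDiff ℝ (⊤ : ℕ∞) ζ) (hp : IsPeriodic ζ) {a b : ℝ} (ha : a ∈ Icc 0 T)
    (hb : b ∈ Icc 0 T) :
    ∫ x, ρ b x * ζ x ∂(cellMeasure d) - ∫ x, ρ a x * ζ x ∂(cellMeasure d) =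
      ∫ s in a..b, ∫ x, ρ s x * fderiv ℝ ζ x (u s x) ∂(cellMeasure d) := by
  have h0 : (0 : ℝ) ∈ Icc 0 T := ⟨le_rfl, hT.le⟩
  rw [hρ.weak ζ hs hp a ha, hρ.weak ζ hs hp b hb, add_sub_add_left_eq_sub]
  exact intervalIntegral.integral_interval_sub_left
    (hρ.intervalIntegrable_flux hflow hu hs hp h0 hb)
    (hρ.intervalIntegrable_flux hflow hu hs hp h0 ha)

/-- The change of u in time is controlled by its Lipschitz bound. The change of ρ in time is
controlled by the equation itself, tested with ψ = ∇ζ · u(t). -/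
lemma IsTransportSolution.abs_flux_sub_le (hρ : IsTransportSolution T u ρ₀ ρ)
    (hflow : IsIncompressibleFlow T u) (hu : HasRegularity T K u) (hT : 0 < T) {ζ : E d → ℝ}
    {A : ℝ} (hζ : IsTest A ζ) {t s : ℝ} (ht : t ∈ Icc 0 T) (hs : s ∈ Icc 0 T) :
    |∫ x, ρ s x * fderiv ℝ ζ x (u s x) ∂(cellMeasure d) -
      ∫ x, ρ t x * fderiv ℝ ζ x (u t x) ∂(cellMeasure d)| ≤ A * (K + 2 * K ^ 2) * |s - t| := by
  have hA := hζ.nonneg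
  have hK := hu.nonneg
  have hDc : Continuous (fderiv ℝ ζ) := hζ.smooth.continuous_fderiv (by simp)
  set ψ : E d → ℝ := fun x => fderiv ℝ ζ x (u t x) with hψ
  have hψs : ContDiff ℝ (⊤ : ℕ∞) ψ :=
    (hζ.smooth.fderiv_right (by simp)).clm_apply (hu.smooth t ht)
  have hψp : IsPeriodic ψ := by
    intro i x
    simp only [hψ, hζ.periodic.fderiv i x, hflow.periodic t ht i x]
  have hψL : ∀ x y, ‖ψ x - ψ y‖ ≤ 2 * A * K * ‖x - y‖ := by
    intro x y
    have : ψ x - ψ y = (fderiv ℝ ζ x - fderiv ℝ ζ y) (u t x) + fderiv ℝ ζ y (u t x - u t y) := by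
      simp only [hψ, sub_apply, map_sub]; ring
    rw [this]
    calc _ ≤ _ := norm_add_le _ _
      _ ≤ (A * ‖x - y‖) * K + A * (K * ‖x - y‖) := by
          refine add_le_add ((ContinuousLinearMap.le_opNorm _ _).trans ?_)
            ((ContinuousLinearMap.le_opNorm _ _).trans ?_)
          · exact mul_le_mul (hζ.fderiv_lipschitz x y) (hu.norm_le t ht x) (norm_nonneg _)
              (by positivity)
          · exact mul_le_mul (hζ.norm_fderiv_le y) (hu.lipschitz t ht x y) (norm_nonneg _) hA
      _ = _ := by ring
  have hψD : ∀ x, ‖fderiv ℝ ψ x‖ ≤ 2 * A * K := fun x =>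
    norm_fderiv_le_of_lip' ℝ (by positivity) (Filter.Eventually.of_forall fun y => hψL y x)
  have hbound : ∀ r ∈ Icc 0 T, ∀ x, |fderiv ℝ ζ x (u r x)| ≤ A * K := fun r hr x =>
    (ContinuousLinearMap.le_opNorm _ _).trans
      (mul_le_mul (hζ.norm_fderiv_le x) (hu.norm_le r hr x) (norm_nonneg _) hA)
  have hi1 : Integrable (fun x => ρ s x * fderiv ℝ ζ x (u s x)) (cellMeasure d) :=
    hρ.integrable_mul hs (hDc.clm_apply (hu.smooth s hs).continuous) (hbound s hs)
  have hi2 : Integrable (fun x => ρ s x * ψ x) (cellMeasure d) :=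
    hρ.integrable_mul hs hψs.continuous (hbound t ht)
  have hfirst : |∫ x, ρ s x * fderiv ℝ ζ x (u s x) ∂(cellMeasure d) -
      ∫ x, ρ s x * ψ x ∂(cellMeasure d)| ≤ A * (K * |s - t|) := by
    rw [← integral_sub hi1 hi2]
    refine abs_integral_cell_le fun x => ?_
    rw [← mul_sub, abs_mul, hψ, ← map_sub]
    calc _ ≤ 1 * (A * (K * |s - t|)) := by
          refine mul_le_mul (hρ.abs_apply_le hs x) ?_ (abs_nonneg _) zero_le_one
          rw [← Real.norm_eq_abs]
          refine (ContinuousLinearMap.le_opNorm _ _).trans ?_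
          exact mul_le_mul (hζ.norm_fderiv_le x) (hu.lipschitz_time s hs t ht x) (norm_nonneg _) hA
      _ = _ := one_mul _
  have hsecond : |∫ x, ρ s x * ψ x ∂(cellMeasure d) - ∫ x, ρ t x * ψ x ∂(cellMeasure d)| ≤
      2 * A * K * K * |s - t| := by
    rw [hρ.integral_mul_sub hflow hu hT hψs hψp ht hs, ← Real.norm_eq_abs]
    refine intervalIntegral.norm_integral_le_of_norm_le_const fun r hr => ?_
    exact hρ.abs_flux_le hu hψD (uIcc_subset_Icc ht hs (uIoc_subset_uIcc hr))
  have := abs_sub_le (∫ x, ρ s x * fderiv ℝ ζ x (u s x) ∂(cellMeasure d))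
    (∫ x, ρ s x * ψ x ∂(cellMeasure d)) (∫ x, ρ t x * ψ x ∂(cellMeasure d))
  refine this.trans ((add_le_add hfirst hsecond).trans (le_of_eq ?_))
  ring

/-- The weak solution is transported by an Euler step up to an error of second order. -/
lemma IsTransportSolution.abs_step_le (hρ : IsTransportSolution T u ρ₀ ρ)
    (hflow : IsIncompressibleFlow T u) (hu : HasRegularity T K u) (hT : 0 < T) {ζ : E d → ℝ}
    {A : ℝ} (hζ : IsTest A ζ) {t h : ℝ} (hh : 0 ≤ h) (ht : t ∈ Icc 0 T) (hth : t + h ∈ Icc 0 T) :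
    |∫ x, ρ (t + h) x * ζ x ∂(cellMeasure d) -
      ∫ x, ρ t x * ζ (eulerStep h (u t) x) ∂(cellMeasure d)| ≤ A * (K + 3 * K ^ 2) * h ^ 2 := by
  have hA := hζ.nonneg
  have hK := hu.nonneg
  have hDc : Continuous (fderiv ℝ ζ) := hζ.smooth.continuous_fderiv (by simp)
  set Q : ℝ := ∫ x, ρ t x * fderiv ℝ ζ x (u t x) ∂(cellMeasure d) with hQ
  -- Both the true increment of ∫ρζ and the increment from the Euler step equal h * Q up to O(h²):
  -- here by Lipschitz continuity of the flux, in `h2` by Taylor expansion of ζ.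
  have h1 : |∫ x, ρ (t + h) x * ζ x ∂(cellMeasure d) - ∫ x, ρ t x * ζ x ∂(cellMeasure d) - h * Q|
      ≤ A * (K + 2 * K ^ 2) * h * h := by
    have hconst : h * Q = ∫ _ in t..(t + h), Q := by simp
    rw [hρ.integral_mul_sub hflow hu hT hζ.smooth hζ.periodic ht hth, hconst,
      ← intervalIntegral.integral_sub
        (hρ.intervalIntegrable_flux hflow hu hζ.smooth hζ.periodic ht hth) (by simp)]
    have hb : ∀ s ∈ uIoc t (t + h),
        ‖(∫ x, ρ s x * fderiv ℝ ζ x (u s x) ∂(cellMeasure d)) - Q‖ ≤ A * (K + 2 * K ^ 2) * h := by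
      intro s hs
      refine (hρ.abs_flux_sub_le hflow hu hT hζ ht
        (uIcc_subset_Icc ht hth (uIoc_subset_uIcc hs))).trans ?_
      gcongr
      rw [uIoc_of_le (by linarith)] at hs
      rw [abs_of_nonneg (by linarith [hs.1])]
      linarith [hs.2]
    have := intervalIntegral.norm_integral_le_of_norm_le_const hb
    rwa [add_sub_cancel_left, abs_of_nonneg hh] at this
  obtain ⟨B, -, hB⟩ := hζ.periodic.exists_norm_le hζ.smooth.continuous
  have hΦ : Continuous (eulerStep h (u t)) :=
    continuous_id.add ((hu.smooth t ht).continuous.const_smul h)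
  have hbound : ∀ x, |fderiv ℝ ζ x (u t x)| ≤ A * K := fun x =>
    (ContinuousLinearMap.le_opNorm _ _).trans
      (mul_le_mul (hζ.norm_fderiv_le x) (hu.norm_le t ht x) (norm_nonneg _) hA)
  have h2 : |∫ x, ρ t x * ζ (eulerStep h (u t) x) ∂(cellMeasure d) -
      ∫ x, ρ t x * ζ x ∂(cellMeasure d) - h * Q| ≤ A * (h * K) ^ 2 := by
    have hi1 : Integrable (fun x => ρ t x * ζ (eulerStep h (u t) x)) (cellMeasure d) :=
      hρ.integrable_mul ht (hζ.smooth.continuous.comp hΦ) fun x => hB _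
    have hi2 := hρ.integrable_mul ht hζ.smooth.continuous hB
    have hi3 := (hρ.integrable_mul ht (hDc.clm_apply (hu.smooth t ht).continuous) hbound).const_mul h
    have hi12 : Integrable (fun x => ρ t x * ζ (eulerStep h (u t) x) - ρ t x * ζ x)
      (cellMeasure d) := hi1.sub hi2
    rw [hQ, ← integral_const_mul, ← integral_sub hi1 hi2, ← integral_sub hi12 hi3]
    refine abs_integral_cell_le fun x => ?_
    have : ρ t x * ζ (eulerStep h (u t) x) - ρ t x * ζ x - h * (ρ t x * fderiv ℝ ζ x (u t x)) =
        ρ t x * (ζ (eulerStep h (u t) x) - ζ x - h * fderiv ℝ ζ x (u t x)) := by ring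
    rw [this, abs_mul]
    calc _ ≤ 1 * (A * (h * K) ^ 2) := mul_le_mul (hρ.abs_apply_le ht x)
            (hζ.abs_taylor_le hh (hu.norm_le t ht) x) (abs_nonneg _) zero_le_one
      _ = _ := one_mul _
  rw [abs_le] at h1 h2 ⊢
  constructor <;> nlinarith

/-- The weak solution is transported by the Euler scheme up to an error of first order. -/
lemma IsTransportSolution.abs_eulerFlow_le (hρ : IsTransportSolution T u ρ₀ ρ)
    (hflow : IsIncompressibleFlow T u) (hu : HasRegularity T K u) (hT : 0 < T) {h : ℝ}
    (hh : 0 ≤ h) (hhK : h * K ≤ 1) (k : ℕ) (hk : k * h ≤ T) {ζ : E d → ℝ} {A : ℝ}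
    (hζ : IsTest A ζ) :
    |∫ x, ρ (k * h) x * ζ x ∂(cellMeasure d) -
      ∫ x, ρ₀ x * ζ (eulerFlow h (fun j => u (j * h)) k x) ∂(cellMeasure d)| ≤
        k * (A * Real.exp (4 * h * K * k) * (K + 3 * K ^ 2) * h ^ 2) := by
  induction k generalizing ζ A with
  | zero =>
    have := hρ.weak ζ hζ.smooth hζ.periodic 0 ⟨le_rfl, hT.le⟩
    simp [eulerFlow, this]
  | succ k ih =>
    have hA := hζ.nonneg
    have hK := hu.nonneg
    push_cast at hk ⊢
    have hkT : (k : ℝ) * h ≤ T := by nlinarith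
    have ht : (k : ℝ) * h ∈ Icc 0 T := ⟨by positivity, hkT⟩
    have hth : (k : ℝ) * h + h ∈ Icc 0 T := ⟨by positivity, by linarith⟩
    -- The last step is moved onto the test function, at the price of a factor exp (4 * h * K) in A;
    -- the induction hypothesis then applies at time k * h.
    have hζ' := hζ.comp_eulerStep (hu.smooth _ ht) (hflow.periodic _ ht) hh hK hhK
      (hu.lipschitz _ ht) (hu.norm_fderiv_le _ ht) (hu.fderiv_lipschitz _ ht)
    have h1 := hρ.abs_step_le hflow hu hT hζ hh ht hth
    have h2 := ih hkT hζ'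
    have h3 := (abs_sub_le _ _ _).trans (add_le_add h1 h2)
    rw [show ((k : ℝ) + 1) * h = k * h + h by ring]
    refine h3.trans ?_
    have e1 : A * Real.exp (4 * h * K) * Real.exp (4 * h * K * k) =
        A * Real.exp (4 * h * K * (k + 1)) := by
      rw [mul_assoc, ← Real.exp_add]; congr 2; ring
    have e2 : A ≤ A * Real.exp (4 * h * K * (k + 1)) :=
      le_mul_of_one_le_right hA (Real.one_le_exp (by positivity))
    rw [e1, add_comm, add_mul, one_mul]
    gcongr

end Weak

/-! ### The gradient norm as a function of time, and its Riemann sums -/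

lemma gradNorm_le {F : Type*} [NormedAddCommGroup F] [NormedSpace ℝ F] {f : E d → F} {K : ℝ}
    (p : ℝ≥0∞) (h : ∀ x, ‖fderiv ℝ f x‖ ≤ K) : gradNorm p f ≤ ENNReal.ofReal K := by
  refine (eLpNorm_le_of_ae_bound (Filter.Eventually.of_forall h)).trans ?_
  simp

/-- Minkowski's inequality. Lipschitz dependence on time makes the sum over the grid times
comparable with the time integral. -/
lemma HasRegularity.abs_gradNorm_sub_le {T K : ℝ} {u : ℝ → E d → E d} (hu : HasRegularity T K u)
    {p : ℝ≥0∞} (hp : 1 ≤ p) {t s : ℝ} (ht : t ∈ Icc 0 T) (hs : s ∈ Icc 0 T) :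
    |(gradNorm p (u t)).toReal - (gradNorm p (u s)).toReal| ≤ K * |t - s| := by
  have key : ∀ t ∈ Icc 0 T, ∀ s ∈ Icc 0 T,
      (gradNorm p (u t)).toReal ≤ (gradNorm p (u s)).toReal + K * |t - s| := by
    intro t ht s hs
    have hct : Continuous (fderiv ℝ (u t)) := (hu.smooth t ht).continuous_fderiv (by simp)
    have hcs : Continuous (fderiv ℝ (u s)) := (hu.smooth s hs).continuous_fderiv (by simp)
    have htop : gradNorm p (u s) ≠ ∞ :=
      ne_top_of_le_ne_top ENNReal.ofReal_ne_top (gradNorm_le p (hu.norm_fderiv_le s hs))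
    have h1 : gradNorm p (u t) ≤ gradNorm p (u s) + ENNReal.ofReal (K * |t - s|) := by
      have h2 : fderiv ℝ (u t) = fderiv ℝ (u s) + (fderiv ℝ (u t) - fderiv ℝ (u s)) := by simp
      have h3 : eLpNorm (fderiv ℝ (u t) - fderiv ℝ (u s)) p (cellMeasure d) ≤
          ENNReal.ofReal (K * |t - s|) := by
        refine (eLpNorm_le_of_ae_bound (Filter.Eventually.of_forall
          (hu.fderiv_lipschitz_time t ht s hs))).trans ?_
        simp
      calc gradNorm p (u t) = eLpNorm (fderiv ℝ (u s) + (fderiv ℝ (u t) - fderiv ℝ (u s))) p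
            (cellMeasure d) := by rw [← h2]; rfl
        _ ≤ _ := (eLpNorm_add_le hcs.aestronglyMeasurable (hct.sub hcs).aestronglyMeasurable hp).trans
            (add_le_add le_rfl h3)
    have h4 := ENNReal.toReal_mono (ENNReal.add_ne_top.2 ⟨htop, ENNReal.ofReal_ne_top⟩) h1
    rwa [ENNReal.toReal_add htop ENNReal.ofReal_ne_top,
      ENNReal.toReal_ofReal (mul_nonneg hu.nonneg (abs_nonneg _))] at h4
  have h1 := key t ht s hs
  have h2 := key s hs t ht
  rw [abs_sub_comm s t] at h2
  rw [abs_le]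
  constructor <;> linarith

/-- Riemann sums of a Lipschitz function. -/
lemma sum_le_integral_add {f : ℝ → ℝ} {T K h : ℝ} {n : ℕ}
    (hf : ∀ t ∈ Icc 0 T, ∀ s ∈ Icc 0 T, |f t - f s| ≤ K * |t - s|) (hK : 0 ≤ K) (hh : 0 ≤ h)
    (hn : n * h = T) :
    ∑ k ∈ Finset.range n, h * f (k * h) ≤ (∫ t in (0 : ℝ)..T, f t) + K * T * h := by
  have hmem : ∀ k : ℕ, k ≤ n → (k : ℝ) * h ∈ Icc 0 T := fun k hk =>
    ⟨by positivity, by rw [← hn]; gcongr⟩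
  have hcont : ContinuousOn f (Icc 0 T) := by
    refine (LipschitzOnWith.of_dist_le_mul (K := K.toNNReal) fun x hx y hy => ?_).continuousOn
    rw [Real.coe_toNNReal K hK, Real.dist_eq, Real.dist_eq]
    exact hf x hx y hy
  have hint : ∀ k < n, IntervalIntegrable f volume ((k : ℝ) * h) ((k + 1 : ℕ) * h) := fun k hk =>
    (hcont.mono (uIcc_subset_Icc (hmem k hk.le) (hmem (k + 1) hk))).intervalIntegrable
  have hsum := intervalIntegral.sum_integral_adjacent_intervals
    (a := fun k : ℕ => (k : ℝ) * h) hint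
  simp only [Nat.cast_zero, zero_mul, hn] at hsum
  rw [← hsum]
  have hstep : ∀ k ∈ Finset.range n, h * f (k * h) ≤
      (∫ t in ((k : ℝ) * h)..((k + 1 : ℕ) * h), f t) + K * h * h := by
    intro k hk
    have hkn := Finset.mem_range.1 hk
    have hle : (k : ℝ) * h ≤ (k + 1 : ℕ) * h := by gcongr; simp
    have hlen : ((k + 1 : ℕ) : ℝ) * h - k * h = h := by push_cast; ring
    have h1 : ∫ _ in ((k : ℝ) * h)..((k + 1 : ℕ) * h), (f (k * h) - K * h) ≤
        ∫ t in ((k : ℝ) * h)..((k + 1 : ℕ) * h), f t := by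
      refine intervalIntegral.integral_mono_on hle (by simp) (hint k hkn) fun t ht => ?_
      have ht' : t ∈ Icc 0 T := ⟨(hmem k hkn.le).1.trans ht.1, ht.2.trans (hmem (k + 1) hkn).2⟩
      have h2 := (abs_le.1 (hf t ht' _ (hmem k hkn.le))).1
      have h3 : K * |t - k * h| ≤ K * h := by
        gcongr
        rw [abs_of_nonneg (by linarith [ht.1])]
        linarith [ht.2]
      linarith
    rw [intervalIntegral.integral_const, hlen, smul_eq_mul] at h1
    linarith
  refine (Finset.sum_le_sum hstep).trans ?_
  rw [Finset.sum_add_distrib, Finset.sum_const, Finset.card_range, nsmul_eq_mul, ← hn]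
  apply le_of_eq
  ring

/-! ### The transported test function and the lower bound for the negative norm -/

/-- McShane extension of `ζ ∘ Ψ⁻¹` from the image of a periodic set, as a periodic function. -/
lemma exists_periodic_extension {ζ : E d → ℝ} (hζp : IsPeriodic ζ) (hζ1 : ∀ x, |ζ x| ≤ 1)
    {Ψ : E d → E d} (hΨ : IsEquivariant Ψ) {G : Set (E d)} (hG : IsPeriodic fun x => x ∈ G)
    {L : ℝ} (hL : 0 ≤ L) (hlip : ∀ x ∈ G, ∀ y ∈ G, |ζ x - ζ y| ≤ L * ‖Ψ x - Ψ y‖) :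
    ∃ η : E d → ℝ, IsPeriodic η ∧ (∀ x, |η x| ≤ 1) ∧ (∀ x y, |η x - η y| ≤ L * ‖x - y‖) ∧
      ∀ x ∈ G, η (Ψ x) = ζ x := by
  rcases G.eq_empty_or_nonempty with rfl | hne
  · exact ⟨fun _ => 0, fun _ _ => rfl, by simp, fun x y => by simpa using by positivity, by simp⟩
  have : Nonempty G := hne.to_subtype
  -- Indexing by points of G instead of points of the image avoids an inverse of Ψ; `hlip` already
  -- forces equal values of ζ over equal images.
  set q : E d → ℝ := fun z => ⨅ x : G, (ζ x + L * ‖z - Ψ x‖) with hq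
  have hbdd : ∀ z, BddBelow (range fun x : G => ζ x + L * ‖z - Ψ x‖) := by
    intro z
    refine ⟨-1, ?_⟩
    rintro _ ⟨x, rfl⟩
    have h1 := (abs_le.1 (hζ1 x)).1
    have h2 : 0 ≤ L * ‖z - Ψ x‖ := by positivity
    simp only
    linarith
  have hqle : ∀ z, ∀ x ∈ G, q z ≤ ζ x + L * ‖z - Ψ x‖ := fun z x hx =>
    ciInf_le (hbdd z) (⟨x, hx⟩ : G)
  have hqlip : ∀ z w, q z ≤ q w + L * ‖z - w‖ := by
    intro z w
    rw [← sub_le_iff_le_add]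
    refine le_ciInf fun x => ?_
    have h1 := hqle z x x.2
    have h2 : L * ‖z - Ψ x‖ ≤ L * (‖z - w‖ + ‖w - Ψ x‖) := by
      gcongr
      exact norm_sub_le_norm_sub_add_norm_sub z w (Ψ x)
    linarith
  have hqper : ∀ v ∈ lattice d, ∀ z, q (z + v) ≤ q z := by
    intro v hv z
    refine le_ciInf fun x => ?_
    have hxv : (x : E d) + v ∈ G := by
      have := hG.add_lattice hv (x : E d)
      simp only [eq_iff_iff] at this
      exact this.2 x.2
    have h1 := hqle (z + v) _ hxv
    rwa [hζp.add_lattice hv, hΨ.add_lattice hv, add_sub_add_right_eq_sub] at h1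
  refine ⟨fun z => max (-1) (min 1 (q z)), ?_, ?_, ?_, ?_⟩
  · intro i x
    have hv : EuclideanSpace.single i 1 ∈ lattice d :=
      Submodule.subset_span ⟨i, stdBasis_apply i⟩
    have h1 := hqper _ hv x
    -- The one-sided inequality for the opposite lattice vector turns it into equality.
    have h2 := hqper _ (neg_mem hv) (x + EuclideanSpace.single i 1)
    rw [add_neg_cancel_right] at h2
    simp only [le_antisymm h1 h2]
  · intro x
    rw [abs_le]
    exact ⟨le_max_left _ _, max_le (by norm_num) (min_le_left _ _)⟩
  · intro x y
    have h1 : |q x - q y| ≤ L * ‖x - y‖ := by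
      have h2 := hqlip x y
      have h3 := hqlip y x
      rw [norm_sub_rev y x] at h3
      rw [abs_le]
      constructor <;> linarith
    refine le_trans ?_ h1
    have h2 := abs_max_sub_max_le_abs (min 1 (q x)) (min 1 (q y)) (-1)
    simp only [max_comm (-1 : ℝ)]
    refine h2.trans ?_
    have h3 := abs_min_sub_min_le_max 1 (q x) 1 (q y)
    simpa using h3
  · intro x hx
    have h1 : q (Ψ x) = ζ x := by
      refine le_antisymm (by simpa using hqle (Ψ x) x hx) (le_ciInf fun y => ?_)
      have := (abs_le.1 (hlip x hx y y.2)).2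
      linarith
    have h2 := abs_le.1 (hζ1 x)
    simp only [h1]
    rw [min_eq_right h2.2, max_eq_right h2.1]

/-- The cell has measure 1, so a sup bound on the gradient is also an L² bound. -/
lemma ofReal_le_hMinusOneNorm {f ζ : E d → ℝ} (hs : ContDiff ℝ (⊤ : ℕ∞) ζ) (hp : IsPeriodic ζ)
    {L : ℝ} (hL : 0 < L) (hD : ∀ x, ‖fderiv ℝ ζ x‖ ≤ L) :
    ENNReal.ofReal (L⁻¹ * ∫ x, f x * ζ x ∂(cellMeasure d)) ≤ hMinusOneNorm f := by
  have hs' : ContDiff ℝ (⊤ : ℕ∞) fun x => L⁻¹ * ζ x := contDiff_const.mul hs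
  have hp' : IsPeriodic fun x => L⁻¹ * ζ x := hp.comp fun y => L⁻¹ * y
  have hg : gradNorm 2 (fun x => L⁻¹ * ζ x) ≤ 1 := by
    rw [← ENNReal.ofReal_one]
    refine gradNorm_le 2 fun x => ?_
    rw [fderiv_const_mul ((hs.differentiable (by simp)) x), norm_smul, norm_inv, Real.norm_eq_abs,
      abs_of_pos hL, inv_mul_le_iff₀ hL, mul_one]
    exact hD x
  have h1 : L⁻¹ * ∫ x, f x * ζ x ∂(cellMeasure d) =
      ∫ x, f x * (L⁻¹ * ζ x) ∂(cellMeasure d) := by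
    rw [← integral_const_mul]
    congr 1
    funext x
    ring
  rw [h1]
  unfold hMinusOneNorm
  exact le_iSup_of_le _ (le_iSup_of_le hs' (le_iSup_of_le hp' (le_iSup_of_le hg le_rfl)))

/-- The Euler scheme for an incompressible velocity field almost preserves the measure if the time
step is small. -/
lemma IsIncompressibleFlow.exists_lintegral_eulerFlow_le {T K : ℝ} (hT : 0 < T)
    {u : ℝ → E d → E d} (hflow : IsIncompressibleFlow T u) (hu : HasRegularity T K u) :
    ∃ δ : ℝ, 0 < δ ∧ ∀ (n : ℕ) (h : ℝ), 0 ≤ h → n * h = T → h * K ≤ δ → ∀ k ≤ n,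
      ∀ f : E d → ℝ≥0∞, IsPeriodic f →
        ∫⁻ x, f (eulerFlow h (fun j => u (j * h)) k x) ∂(cellMeasure d) ≤
          2 * ∫⁻ x, f x ∂(cellMeasure d) := by
  have hK := hu.nonneg
  -- Since n * h = T, Bernoulli gives (1 - ε * h * K) ^ n ≥ 1 - ε * T * K ≥ 1 / 2, hence the factor
  -- 2 in the conclusion.
  set ε : ℝ := 1 / (2 * (T * K + 1)) with hε
  have hε0 : 0 < ε := by positivity
  obtain ⟨δ, hδ, hdet⟩ := exists_det_one_add_ge d hε0
  refine ⟨min δ (1 / 2), by positivity, fun n h hh hn hhK k hk f hf => ?_⟩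
  have hhKδ := hhK.trans (min_le_left _ _)
  have hhK2 := hhK.trans (min_le_right _ _)
  have hmem : ∀ j < n, (j : ℝ) * h ∈ Icc 0 T := fun j hj =>
    ⟨by positivity, by rw [← hn]; gcongr⟩
  set c : ℝ := 1 - ε * (h * K) with hc
  have hεhalf : ε ≤ 1 / 2 := by
    rw [hε]
    apply one_div_le_one_div_of_le (by norm_num)
    nlinarith [mul_nonneg hT.le hK]
  have hhK0 : 0 ≤ h * K := mul_nonneg hh hK
  have hc0 : 0 < c := by rw [hc]; nlinarith
  have hc1 : c ≤ 1 := by rw [hc]; nlinarith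
  have hcn : 1 / 2 ≤ c ^ n := by
    have h1 := one_add_mul_le_pow (a := -(ε * (h * K))) (by nlinarith) n
    have h2 : (n : ℝ) * (ε * (h * K)) = ε * (T * K) := by rw [← hn]; ring
    have h3 : ε * (T * K) ≤ 1 / 2 := by
      rw [hε, one_div_mul_eq_div, div_le_div_iff₀ (by positivity) (by norm_num)]
      linarith
    have h4 : (1 + -(ε * (h * K))) = c := by rw [hc]; ring
    rw [h4] at h1
    linarith
  have hstep : ∀ j < n, ∀ f : E d → ℝ≥0∞, IsPeriodic f →
      ∫⁻ x, f (eulerStep h (u (j * h)) x) ∂(cellMeasure d) ≤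
        ENNReal.ofReal c⁻¹ * ∫⁻ x, f x ∂(cellMeasure d) := by
    intro j hj f hf
    have hj' := hmem j hj
    have hdetj : ∀ x, c ≤ (ContinuousLinearMap.id ℝ (E d) + h • fderiv ℝ (u (j * h)) x).det := by
      intro x
      have hnorm : ‖h • fderiv ℝ (u (j * h)) x‖ ≤ h * K := by
        rw [norm_smul, Real.norm_eq_abs, abs_of_nonneg hh]
        gcongr
        exact hu.norm_fderiv_le _ hj' x
      refine le_trans ?_ (hdet _ (hnorm.trans hhKδ) ?_)
      · rw [hc]
        gcongr
      · have hdiv := hflow.div_free _ hj' x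
        unfold divergence at hdiv
        simp only [smul_apply, PiLp.smul_apply, smul_eq_mul, ← Finset.mul_sum, hdiv, mul_zero]
    have h1 := lintegral_comp_eulerStep_le ((hu.smooth _ hj').differentiable (by simp))
      (hflow.periodic _ hj') hh (hu.lipschitz _ hj') (by linarith) hdetj hf
    calc _ = ENNReal.ofReal c⁻¹ * (ENNReal.ofReal c *
          ∫⁻ x, f (eulerStep h (u (j * h)) x) ∂(cellMeasure d)) := by
          rw [← mul_assoc, ← ENNReal.ofReal_mul (by positivity), inv_mul_cancel₀ hc0.ne',
            ENNReal.ofReal_one, one_mul]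
      _ ≤ _ := by gcongr
  have h2 := lintegral_comp_eulerFlow_le (h := h) (v := fun j => u (j * h)) (n := n)
    (inv_nonneg.2 hc0.le) (fun j hj => hflow.periodic _ (hmem j hj)) hstep k hk f hf
  refine h2.trans ?_
  gcongr
  rw [show (2 : ℝ≥0∞) = ENNReal.ofReal 2 by norm_num]
  apply ENNReal.ofReal_le_ofReal
  rw [inv_pow, inv_le_comm₀ (by positivity) (by norm_num)]
  have := pow_le_pow_of_le_one hc0.le hc1 hk
  linarith

/-- The lower bound for the `H^{-1}` norm of the transported density in terms of a Lipschitz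
function that is well correlated with the initial density. -/
lemma exists_hMinusOneNorm_ge (d : ℕ) {p : ℝ≥0∞} (hp : 1 < p) : ∃ c : ℝ, 0 < c ∧
    ∀ (T : ℝ), 0 < T → ∀ (u : ℝ → E d → E d) (ρ₀ : E d → ℝ) (ρ : ℝ → E d → ℝ),
      IsIncompressibleFlow T u → IsCriticalMixture ρ₀ → IsTransportSolution T u ρ₀ ρ →
      ∀ (ζ : E d → ℝ) (L : ℝ), 0 < L → IsPeriodic ζ → (∀ x, |ζ x| ≤ 1) →
        (∀ x y, |ζ x - ζ y| ≤ L * ‖x - y‖) → 3 / 4 ≤ ∫ x, ρ₀ x * ζ x ∂(cellMeasure d) →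
        ENNReal.ofReal (1 / (4 * L) *
          Real.exp (-c * ((∫ t in (0 : ℝ)..T, (gradNorm p (u t)).toReal) + 1))) ≤
          hMinusOneNorm (ρ T) := by
  obtain ⟨C, hC, hlusin⟩ := exists_lusin_lipschitz d hp
  obtain ⟨Ck, hCk, hker⟩ := exists_isKernel d
  refine ⟨128 * C, by positivity, fun T hT u ρ₀ ρ hflow hρ₀ hρ ζ L₀ hL₀ hζp hζ1 hζL hcorr => ?_⟩
  obtain ⟨K, hu⟩ := hflow.exists_hasRegularity hT
  have hK := hu.nonneg
  set N : ℝ → ℝ := fun t => (gradNorm p (u t)).toReal with hN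
  set I : ℝ := ∫ t in (0 : ℝ)..T, N t with hI
  have hI0 : 0 ≤ I := intervalIntegral.integral_nonneg hT.le fun t _ => ENNReal.toReal_nonneg
  -- Sixteen times the bound for ∫ g proved below, so that 2 / lam * ∫ g ≤ 1 / 8. The 1 absorbs the
  -- error of the Riemann sum and keeps lam positive.
  set lam : ℝ := 64 * C * (I + 1) with hlam
  have hlam0 : 0 < lam := by positivity
  set L : ℝ := L₀ * Real.exp (2 * lam) with hL
  have hLpos : 0 < L := by positivity
  -- At this scale, mollifying a function with Lipschitz constant L moves it by at most 1 / 8.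
  obtain ⟨k, hk, hkmod⟩ := hker (1 / (8 * L)) (by positivity)
  set l : ℝ := Ck / (1 / (8 * L)) with hl
  have hl0 : 0 ≤ l := by positivity
  -- A depends on L but not on the time step, so the Euler error can still be made small afterwards.
  set A : ℝ := max L (L * l) with hA
  have hA0 : 0 ≤ A := hLpos.le.trans (le_max_left _ _)
  obtain ⟨δ, hδ, hmp⟩ := hflow.exists_lintegral_eulerFlow_le hT hu
  -- the choice of the time step
  obtain ⟨n, hn0, hnK, hnδ, hnT, hnA⟩ : ∃ n : ℕ, 0 < n ∧ T / n * K ≤ 1 / 2 ∧ T / n * K ≤ δ ∧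
      K * T * (T / n) ≤ 1 ∧
      T * (A * Real.exp (4 * K * T) * (K + 3 * K ^ 2)) * (T / n) ≤ 1 / 4 := by
    have hlim : Filter.Tendsto (fun n : ℕ => T / (n : ℝ)) Filter.atTop (nhds 0) :=
      tendsto_const_div_atTop_nhds_zero_nat T
    have hev : ∀ a b : ℝ, 0 < b → ∀ᶠ n : ℕ in Filter.atTop, a * (T / n) ≤ b := by
      intro a b hb
      have h1 := hlim.const_mul a
      rw [mul_zero] at h1
      exact (h1.eventually (gt_mem_nhds hb)).mono fun n hn => hn.le
    have h1 := hev K (1 / 2) (by norm_num)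
    have h2 := hev K δ hδ
    have h3 := hev (K * T) 1 one_pos
    have h4 := hev (T * (A * Real.exp (4 * K * T) * (K + 3 * K ^ 2))) (1 / 4) (by norm_num)
    obtain ⟨n, h5, h6, h7, h8, h9⟩ :=
      ((Filter.eventually_gt_atTop 0).and (h1.and (h2.and (h3.and h4)))).exists
    exact ⟨n, h5, by rw [mul_comm]; exact h6, by rw [mul_comm]; exact h7, h8, h9⟩
  set h : ℝ := T / n with hh
  have hn0' : (0 : ℝ) < n := by exact_mod_cast hn0
  have hhpos : 0 < h := by positivity
  have hnh : n * h = T := by rw [hh]; field_simp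
  set v : ℕ → E d → E d := fun j => u (j * h) with hv
  have hmem : ∀ j < n, (j : ℝ) * h ∈ Icc 0 T := fun j hj =>
    ⟨by positivity, by rw [← hnh]; gcongr⟩
  set Ψ : ℕ → E d → E d := eulerFlow h v with hΨ
  have hΨe : ∀ j ≤ n, IsEquivariant (Ψ j) :=
    IsEquivariant.eulerFlow fun j hj => hflow.periodic _ (hmem j hj)
  have hΨc : ∀ j ≤ n, Continuous (Ψ j) :=
    continuous_eulerFlow fun j hj => (hu.smooth _ (hmem j hj)).continuous
  -- the pointwise Lipschitz bounds
  have hmex : ∀ j : ℕ, ∃ m : E d → ℝ, j < n → Measurable m ∧ IsPeriodic m ∧ (∀ x, 0 ≤ m x) ∧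
      (∀ x y, ‖v j x - v j y‖ ≤ ‖x - y‖ * (m x + m y)) ∧
      ∫⁻ x, ENNReal.ofReal (m x) ∂(cellMeasure d) ≤ ENNReal.ofReal (C * N (j * h)) := by
    intro j
    by_cases hj : j < n
    · have hj' := hmem j hj
      obtain ⟨m, h1, h2, h3, h4, h5⟩ := hlusin (u (j * h)) ((hu.smooth _ hj').of_le (by simp))
        (hflow.periodic _ hj')
      refine ⟨m, fun _ => ⟨h1, h2, h3, h4, h5.trans (le_of_eq ?_)⟩⟩
      rw [ENNReal.ofReal_mul hC.le, hN, ENNReal.ofReal_toReal]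
      exact ne_top_of_le_ne_top ENNReal.ofReal_ne_top (gradNorm_le p (hu.norm_fderiv_le _ hj'))
    · exact ⟨0, fun h => absurd h hj⟩
  choose m hm using hmex
  set g : E d → ℝ := fun x => ∑ j ∈ Finset.range n, 2 * h * m j (Ψ j x) with hg
  have hterm0 : ∀ j ∈ Finset.range n, ∀ x, 0 ≤ 2 * h * m j (Ψ j x) := fun j hj x =>
    mul_nonneg (by positivity) ((hm j (Finset.mem_range.1 hj)).2.2.1 _)
  have hg0 : ∀ x, 0 ≤ g x := fun x => Finset.sum_nonneg fun j hj => hterm0 j hj x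
  have htermm : ∀ j ∈ Finset.range n, Measurable fun x => 2 * h * m j (Ψ j x) := fun j hj =>
    ((hm j (Finset.mem_range.1 hj)).1.comp
      (hΨc j (Finset.mem_range.1 hj).le).measurable).const_mul _
  have hgm : Measurable g := Finset.measurable_fun_sum _ htermm
  have hgp : IsPeriodic g := by
    intro i x
    refine Finset.sum_congr rfl fun j hj => ?_
    have hj' := Finset.mem_range.1 hj
    rw [(hΨe j hj'.le) i x, (hm j hj').2.1 i]
  have hsep : ∀ x y, ‖x - y‖ ≤ Real.exp (g x + g y) * ‖Ψ n x - Ψ n y‖ := fun x y =>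
    norm_sub_le_eulerFlow hhpos.le (fun j hj => hu.lipschitz _ (hmem j hj)) hnK
      (fun j hj => (hm j hj).2.2.2.1) x y n le_rfl
  have hglint : ∫⁻ x, ENNReal.ofReal (g x) ∂(cellMeasure d) ≤ ENNReal.ofReal (4 * C * (I + 1)) := by
    calc _ = ∫⁻ x, ∑ j ∈ Finset.range n, ENNReal.ofReal (2 * h * m j (Ψ j x)) ∂(cellMeasure d) := by
          refine lintegral_congr fun x => ?_
          rw [hg, ENNReal.ofReal_sum_of_nonneg fun j hj => hterm0 j hj x]
      _ = ∑ j ∈ Finset.range n, ∫⁻ x, ENNReal.ofReal (2 * h * m j (Ψ j x)) ∂(cellMeasure d) :=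
          lintegral_finsetSum _ fun j hj => (htermm j hj).ennreal_ofReal
      _ ≤ ∑ j ∈ Finset.range n, ENNReal.ofReal (4 * C * (h * N (j * h))) := by
          refine Finset.sum_le_sum fun j hj => ?_
          have hj' := Finset.mem_range.1 hj
          obtain ⟨-, h2, -, -, h5⟩ := hm j hj'
          have h6 := hmp n h hhpos.le hnh hnδ j hj'.le (fun x => ENNReal.ofReal (2 * h * m j x))
            (h2.comp fun y => ENNReal.ofReal (2 * h * y))
          refine h6.trans ?_
          simp_rw [ENNReal.ofReal_mul (by positivity : 0 ≤ 2 * h)]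
          rw [lintegral_const_mul' _ _ ENNReal.ofReal_ne_top]
          calc _ ≤ 2 * (ENNReal.ofReal (2 * h) * ENNReal.ofReal (C * N (j * h))) := by gcongr
            _ = _ := by
              rw [← ENNReal.ofReal_mul (by positivity), show (2 : ℝ≥0∞) = ENNReal.ofReal 2 by norm_num,
                ← ENNReal.ofReal_mul (by norm_num)]
              congr 1
              ring
      _ = ENNReal.ofReal (4 * C * ∑ j ∈ Finset.range n, h * N (j * h)) := by
          rw [Finset.mul_sum, ENNReal.ofReal_sum_of_nonneg]
          exact fun j _ => mul_nonneg (by positivity) (mul_nonneg hhpos.le ENNReal.toReal_nonneg)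
      _ ≤ _ := by
          apply ENNReal.ofReal_le_ofReal
          gcongr
          have := sum_le_integral_add (f := N)
            (fun t ht s hs => hu.abs_gradNorm_sub_le hp.le ht hs) hK hhpos.le hnh
          linarith
  have hgint : Integrable g (cellMeasure d) := by
    refine ⟨hgm.aestronglyMeasurable, ?_⟩
    rw [hasFiniteIntegral_iff_ofReal (Filter.Eventually.of_forall hg0)]
    exact hglint.trans_lt ENNReal.ofReal_lt_top
  have hgI : ∫ x, g x ∂(cellMeasure d) ≤ 4 * C * (I + 1) := by
    rw [integral_eq_lintegral_of_nonneg_ae (Filter.Eventually.of_forall hg0)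
      hgm.aestronglyMeasurable]
    exact ENNReal.toReal_le_of_le_ofReal (by positivity) hglint
  -- the test function at the final time
  obtain ⟨η, hηp, hη1, hηL, hηΨ⟩ := exists_periodic_extension hζp hζ1 (hΨe n le_rfl)
    (G := {x | g x ≤ lam}) (hgp.comp fun y => y ≤ lam) hLpos.le (by
      intro x hx y hy
      refine (hζL x y).trans ?_
      rw [hL, mul_assoc]
      gcongr
      refine (hsep x y).trans ?_
      gcongr
      have h1 : g x ≤ lam := hx
      have h2 : g y ≤ lam := hy
      linarith)
  have hηc : Continuous η := by
    refine (LipschitzWith.of_dist_le_mul (K := L.toNNReal) fun x y => ?_).continuous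
    rw [Real.coe_toNNReal L hLpos.le, Real.dist_eq, dist_eq_norm]
    exact hηL x y
  have hηm := hηc.measurable
  set θ : E d → ℝ := mollify k η with hθ
  have hθs : ContDiff ℝ (⊤ : ℕ∞) θ := hk.contDiff_mollify hηm hη1
  have hθL : ∀ x y, |θ x - θ y| ≤ L * ‖x - y‖ := hk.abs_mollify_sub_mollify_le hηm hη1 hηL
  have hθD : ∀ x, ‖fderiv ℝ θ x‖ ≤ L := fun x =>
    norm_fderiv_le_of_lip' ℝ hLpos.le (Filter.Eventually.of_forall fun y => hθL y x)
  have hθη : ∀ x, |θ x - η x| ≤ 1 / 8 := by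
    intro x
    refine (hk.abs_mollify_sub_le hηm hη1 hLpos.le hηL x).trans (le_of_eq ?_)
    field_simp
  have hθt : IsTest A θ := by
    refine ⟨hθs, hηp.mollify k, fun x => (hθD x).trans (le_max_left _ _), fun x y => ?_⟩
    refine (hk.norm_fderiv_mollify_sub_le hηm hη1 hLpos.le hηL hl0 hkmod x y).trans ?_
    gcongr
    exact le_max_right _ _
  have hρ₀1 : ∀ x, |ρ₀ x| ≤ 1 := fun x => by rcases hρ₀.values x with h | h <;> simp [h]
  have hζc : Continuous ζ := by
    refine (LipschitzWith.of_dist_le_mul (K := L₀.toNNReal) fun x y => ?_).continuous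
    rw [Real.coe_toNNReal L₀ hL₀.le, Real.dist_eq, dist_eq_norm]
    exact hζL x y
  have hpoint : ∀ x, ρ₀ x * ζ x - (2 / lam * g x + 1 / 8) ≤ ρ₀ x * θ (Ψ n x) := by
    intro x
    -- Chebyshev in pointwise form: the left side is zero where g ≤ lam and at most 2 elsewhere.
    have h1 : |η (Ψ n x) - ζ x| ≤ 2 / lam * g x := by
      by_cases hx : g x ≤ lam
      · rw [hηΨ x hx]
        simpa using mul_nonneg (by positivity) (hg0 x)
      · calc |η (Ψ n x) - ζ x| ≤ |η (Ψ n x)| + |ζ x| := abs_sub _ _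
          _ ≤ 2 := by linarith [hη1 (Ψ n x), hζ1 x]
          _ = 2 / lam * lam := by field_simp
          _ ≤ _ := by gcongr; exact (not_le.1 hx).le
    have h2 := hθη (Ψ n x)
    have h3 : |ρ₀ x * (θ (Ψ n x) - ζ x)| ≤ 2 / lam * g x + 1 / 8 := by
      rw [abs_mul]
      have h4 := abs_sub_le (θ (Ψ n x)) (η (Ψ n x)) (ζ x)
      calc _ ≤ 1 * |θ (Ψ n x) - ζ x| := by gcongr; exact hρ₀1 x
        _ ≤ _ := by linarith
    have := (abs_le.1 h3).1
    linarith
  have hbdd : ∀ f : E d → ℝ, Continuous f → (∀ x, |f x| ≤ 1) →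
      Integrable (fun x => ρ₀ x * f x) (cellMeasure d) := by
    intro f hf hf1
    refine Integrable.of_bound (C := 1) (hρ₀.measurable.mul hf.measurable).aestronglyMeasurable
      (Filter.Eventually.of_forall fun x => ?_)
    rw [Real.norm_eq_abs, abs_mul]
    exact mul_le_one₀ (hρ₀1 x) (abs_nonneg _) (hf1 x)
  -- From 3 / 4, the bad set takes 1 / 8 and the mollification of η another 1 / 8.
  have hhalf : 1 / 2 ≤ ∫ x, ρ₀ x * θ (Ψ n x) ∂(cellMeasure d) := by
    have hi1 := hbdd ζ hζc hζ1
    have hi2 : Integrable (fun x => 2 / lam * g x + 1 / 8) (cellMeasure d) :=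
      (hgint.const_mul _).add (integrable_const _)
    have hi3 : Integrable (fun x => ρ₀ x * θ (Ψ n x)) (cellMeasure d) :=
      hbdd _ (hθs.continuous.comp (hΨc n le_rfl)) fun x => hk.abs_mollify_le hη1 _
    have h1 := integral_mono (hi1.sub hi2) hi3 hpoint
    rw [integral_sub' hi1 hi2, integral_add (hgint.const_mul _) (integrable_const _),
      integral_const_mul] at h1
    simp only [integral_const, probReal_univ, smul_eq_mul, one_mul] at h1
    have h2 : 2 / lam * ∫ x, g x ∂(cellMeasure d) ≤ 1 / 8 := by
      calc _ ≤ 2 / lam * (4 * C * (I + 1)) := by gcongr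
        _ = 1 / 8 := by rw [hlam]; field_simp; norm_num
    linarith
  have hquarter : 1 / 4 ≤ ∫ x, ρ T x * θ x ∂(cellMeasure d) := by
    have h1 := hρ.abs_eulerFlow_le hflow hu hT hhpos.le (by linarith) n hnh.le hθt
    rw [hnh] at h1
    have h2 : n * (A * Real.exp (4 * h * K * n) * (K + 3 * K ^ 2) * h ^ 2) ≤ 1 / 4 := by
      refine le_trans (le_of_eq ?_) hnA
      have : 4 * h * K * n = 4 * K * T := by rw [← hnh]; ring
      rw [this, ← hnh]
      ring
    have h3 := (abs_le.1 (h1.trans h2)).1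
    linarith
  refine le_trans ?_ (ofReal_le_hMinusOneNorm hθs (hηp.mollify k) hLpos hθD)
  apply ENNReal.ofReal_le_ofReal
  have h1 : -(128 * C) * (I + 1) = -(2 * lam) := by rw [hlam]; ring
  rw [h1, Real.exp_neg]
  calc _ = L⁻¹ * (1 / 4) := by rw [hL]; field_simp
    _ ≤ _ := by gcongr

/-! ### Functions of bounded variation: translation and mollification -/

section BV

variable {f ψ : E d → ℝ}

lemma integral_mul_fderiv_le_bvSeminorm (hfin : bvSeminorm f ≠ ∞) (hs : ContDiff ℝ (⊤ : ℕ∞) ψ)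
    (hp : IsPeriodic ψ) (h1 : ∀ x, |ψ x| ≤ 1) (z : E d) :
    ∫ x, f x * fderiv ℝ ψ x z ∂(cellMeasure d) ≤ ‖z‖ * (bvSeminorm f).toReal := by
  rcases eq_or_ne z 0 with rfl | hz
  · simp
  have hz0 : 0 < ‖z‖ := norm_pos_iff.2 hz
  -- A field of constant direction, whose divergence is the derivative of ψ in the unit direction of
  -- z.
  set φ : E d → E d := fun x => ψ x • (‖z‖⁻¹ • z) with hφ
  have hφs : ContDiff ℝ (⊤ : ℕ∞) φ := hs.smul contDiff_const
  have hφp : IsPeriodic φ := hp.comp fun y => y • (‖z‖⁻¹ • z)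
  have hφ1 : ∀ x, ‖φ x‖ ≤ 1 := by
    intro x
    simp only [hφ, norm_smul, norm_inv, norm_norm, inv_mul_cancel₀ hz0.ne', mul_one]
    exact h1 x
  have hdiv : ∀ x, divergence φ x = ‖z‖⁻¹ * fderiv ℝ ψ x z := by
    intro x
    have h2 : fderiv ℝ φ x = (fderiv ℝ ψ x).smulRight (‖z‖⁻¹ • z) :=
      ((hs.differentiable (by simp) x).hasFDerivAt.smul_const _).fderiv
    have h3 : z = ∑ i, z i • (EuclideanSpace.single i 1 : E d) := by
      have := (EuclideanSpace.basisFun (Fin d) ℝ).sum_repr z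
      simpa using this.symm
    simp only [divergence, h2, ContinuousLinearMap.smulRight_apply, PiLp.smul_apply, smul_eq_mul]
    have h4 : fderiv ℝ ψ x z = ∑ i, z i * fderiv ℝ ψ x (EuclideanSpace.single i 1) := by
      conv_lhs => rw [h3, map_sum]
      simp
    rw [h4, Finset.mul_sum]
    exact Finset.sum_congr rfl fun i _ => by ring
  have hle : ENNReal.ofReal (∫ x, f x * divergence φ x ∂(cellMeasure d)) ≤ bvSeminorm f := by
    unfold bvSeminorm
    exact le_iSup_of_le _ (le_iSup_of_le hφs (le_iSup_of_le hφp (le_iSup_of_le hφ1 le_rfl)))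
  have h4 := (ENNReal.ofReal_le_iff_le_toReal hfin).1 hle
  have h5 : ∫ x, f x * divergence φ x ∂(cellMeasure d) =
      ‖z‖⁻¹ * ∫ x, f x * fderiv ℝ ψ x z ∂(cellMeasure d) := by
    rw [← integral_const_mul]
    congr 1
    funext x
    rw [hdiv]
    ring
  rwa [h5, inv_mul_le_iff₀ hz0] at h4

/-- Translations change the pairing with a function of bounded variation at most linearly. -/
lemma abs_integral_mul_sub_translate_le (hf : Measurable f) (hf1 : ∀ x, |f x| ≤ 1)
    (hfin : bvSeminorm f ≠ ∞) (hs : ContDiff ℝ (⊤ : ℕ∞) ψ) (hp : IsPeriodic ψ)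
    (h1 : ∀ x, |ψ x| ≤ 1) (z : E d) :
    |∫ x, f x * ψ x ∂(cellMeasure d) - ∫ x, f x * ψ (x - z) ∂(cellMeasure d)| ≤
      ‖z‖ * (bvSeminorm f).toReal := by
  have hDc : Continuous (fderiv ℝ ψ) := hs.continuous_fderiv (by simp)
  obtain ⟨D, -, hD⟩ := hp.fderiv.exists_norm_le hDc
  have hsub : ∀ s : ℝ, Continuous fun x : E d => x - s • z := fun s => by fun_prop
  have hder : ∀ s : ℝ, HasDerivAt (fun s : ℝ => ∫ x, f x * ψ (x - s • z) ∂(cellMeasure d))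
      (∫ x, f x * fderiv ℝ ψ (x - s • z) (-z) ∂(cellMeasure d)) s := by
    intro s
    refine (hasDerivAt_integral_of_dominated_loc_of_deriv_le (s := univ)
      (F := fun (s : ℝ) x => f x * ψ (x - s • z))
      (F' := fun (s : ℝ) x => f x * fderiv ℝ ψ (x - s • z) (-z))
      (bound := fun _ => D * ‖z‖) Filter.univ_mem ?_ ?_ ?_ ?_ (integrable_const _) ?_).2
    · exact Filter.Eventually.of_forall fun s =>
        (hf.mul (hs.continuous.comp (hsub s)).measurable).aestronglyMeasurable
    · refine Integrable.of_bound (C := 1)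
        (hf.mul (hs.continuous.comp (hsub s)).measurable).aestronglyMeasurable
        (Filter.Eventually.of_forall fun x => ?_)
      rw [Real.norm_eq_abs, abs_mul]
      exact mul_le_one₀ (hf1 x) (abs_nonneg _) (h1 _)
    · have : Continuous fun x : E d => fderiv ℝ ψ (x - s • z) (-z) :=
        (hDc.comp (hsub s)).clm_apply continuous_const
      exact (hf.mul this.measurable).aestronglyMeasurable
    · refine Filter.Eventually.of_forall fun x s _ => ?_
      rw [norm_mul]
      calc _ ≤ 1 * (D * ‖z‖) := by
            refine mul_le_mul (hf1 x) ?_ (norm_nonneg _) zero_le_one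
            refine (ContinuousLinearMap.le_opNorm _ _).trans ?_
            rw [norm_neg]
            gcongr
            exact hD _
        _ = _ := one_mul _
    · refine Filter.Eventually.of_forall fun x s _ => ?_
      have h2 : HasDerivAt (fun s : ℝ => x - s • z) (-z) s := by
        simpa using ((hasDerivAt_id s).smul_const z).const_sub x
      exact (((hs.differentiable (by simp)) _).hasFDerivAt.comp_hasDerivAt s h2).const_mul _
  have hbound : ∀ s : ℝ, ‖∫ x, f x * fderiv ℝ ψ (x - s • z) (-z) ∂(cellMeasure d)‖ ≤
      ‖z‖ * (bvSeminorm f).toReal := by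
    intro s
    have hss : ContDiff ℝ (⊤ : ℕ∞) fun x => ψ (x - s • z) := hs.comp (by fun_prop)
    have hsp : IsPeriodic fun x => ψ (x - s • z) := by
      intro i x
      simp only [add_sub_right_comm, hp i]
    have hsd : ∀ x, fderiv ℝ (fun x => ψ (x - s • z)) x = fderiv ℝ ψ (x - s • z) := fun x => by
      simp only [sub_eq_add_neg]
      exact fderiv_comp_add_right _
    have h2 := integral_mul_fderiv_le_bvSeminorm hfin hss hsp (fun x => h1 _) z
    have h3 := integral_mul_fderiv_le_bvSeminorm hfin hss hsp (fun x => h1 _) (-z)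
    simp only [hsd] at h2 h3
    rw [norm_neg] at h3
    rw [Real.norm_eq_abs, abs_le]
    refine ⟨?_, h3⟩
    simp only [map_neg, mul_neg, integral_neg]
    linarith
  have h2 := convex_univ.norm_image_sub_le_of_norm_hasDerivWithin_le
    (fun s _ => (hder s).hasDerivWithinAt) (fun s _ => hbound s) (mem_univ (1 : ℝ)) (mem_univ 0)
  simpa using h2

/-- By Fubini the pairing with the mollified function is an average of pairings with translates by
vectors of length at most r, each costing at most r times the total variation. -/
lemma IsKernel.integral_mul_sub_le_mollify {k : E d → ℝ} {r : ℝ} (hk : IsKernel k r)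
    (hf : Measurable f) (hf1 : ∀ x, |f x| ≤ 1) (hfin : bvSeminorm f ≠ ∞)
    (hs : ContDiff ℝ (⊤ : ℕ∞) ψ) (hp : IsPeriodic ψ) (h1 : ∀ x, |ψ x| ≤ 1) :
    ∫ x, f x * ψ x ∂(cellMeasure d) - r * (bvSeminorm f).toReal ≤
      ∫ x, f x * mollify k ψ x ∂(cellMeasure d) := by
  have hprod : Integrable (Function.uncurry fun x z => f x * (k z * ψ (x - z)))
      ((cellMeasure d).prod volume) := by
    refine Integrable.mono (hk.integrable.comp_snd (cellMeasure d)) ?_ ?_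
    · have hψ : Measurable fun y : E d × E d => ψ (y.1 - y.2) :=
        (hs.continuous.comp (by fun_prop)).measurable
      exact ((hf.comp measurable_fst).mul
        ((hk.smooth.continuous.measurable.comp measurable_snd).mul hψ)).aestronglyMeasurable
    · refine Filter.Eventually.of_forall fun y => ?_
      simp only [Function.uncurry, norm_mul]
      calc _ ≤ 1 * (‖k y.2‖ * 1) := by
            refine mul_le_mul (hf1 _) ?_ (by positivity) zero_le_one
            exact mul_le_mul_of_nonneg_left (h1 _) (norm_nonneg _)
        _ = _ := by ring
  have hswap : ∫ x, f x * mollify k ψ x ∂(cellMeasure d) =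
      ∫ z, k z * ∫ x, f x * ψ (x - z) ∂(cellMeasure d) := by
    simp only [mollify, ← integral_const_mul]
    rw [integral_integral_swap hprod]
    congr 1
    funext z
    congr 1
    funext x
    ring
  have hi : Integrable fun z => k z * ∫ x, f x * ψ (x - z) ∂(cellMeasure d) := by
    refine hprod.swap.integral_prod_left.congr (Filter.Eventually.of_forall fun z => ?_)
    simp only [Function.comp_apply, Prod.swap, Function.uncurry, ← integral_const_mul]
    congr 1
    funext x
    ring
  have hdiff : ∫ x, f x * ψ x ∂(cellMeasure d) - ∫ x, f x * mollify k ψ x ∂(cellMeasure d) =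
      ∫ z, k z * (∫ x, f x * ψ x ∂(cellMeasure d) - ∫ x, f x * ψ (x - z) ∂(cellMeasure d)) := by
    simp_rw [mul_sub]
    rw [integral_sub (hk.integrable.mul_const _) hi, integral_mul_const, hk.integral_eq, one_mul,
      hswap]
  have hle := hk.abs_integral_mul_le
    (g := fun z => ∫ x, f x * ψ x ∂(cellMeasure d) - ∫ x, f x * ψ (x - z) ∂(cellMeasure d))
    (B := r * (bvSeminorm f).toReal) fun z hz =>
      (abs_integral_mul_sub_translate_le hf hf1 hfin hs hp h1 z).trans (by gcongr)
  rw [← hdiff] at hle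
  linarith [(abs_le.1 hle).2]

end BV

/-- With zero variation, mollification at an arbitrarily large scale would be free. It makes the
test function nearly constant, and a mean-zero density cannot correlate with a constant. -/
lemma IsCriticalMixture.bvSeminorm_ne_zero {ρ₀ : E d → ℝ} (hρ₀ : IsCriticalMixture ρ₀) :
    bvSeminorm ρ₀ ≠ 0 := by
  intro h0
  obtain ⟨C, hC, hker⟩ := exists_isKernel d
  have hρ1 : ∀ x, |ρ₀ x| ≤ 1 := fun x => by rcases hρ₀.values x with h | h <;> simp [h]
  have hsq : ∫ x, ρ₀ x * ρ₀ x ∂(cellMeasure d) = 1 := by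
    have : ∀ x, ρ₀ x * ρ₀ x = 1 := fun x => by rcases hρ₀.values x with h | h <;> simp [h]
    simp [this]
  obtain ⟨ψ, hψs, hψp, hψ1, hψ⟩ := exists_smooth_approx hρ₀.measurable hρ₀.periodic hρ1
    (ε := 1 / 8) (by norm_num)
  -- The mollified function then has Lipschitz constant 1 / (2 * (d + 1)) and deviates from its
  -- value at 0 by at most 1 / 2 on the cell, against a correlation of at least 7 / 8.
  obtain ⟨k, hk, hkmod⟩ := hker (2 * C * (d + 1)) (by positivity)
  have h1 := hk.integral_mul_sub_le_mollify hρ₀.measurable hρ1 (by simp [h0]) hψs hψp hψ1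
  rw [h0, ENNReal.toReal_zero, mul_zero, sub_zero] at h1
  set ζ := mollify k ψ with hζ
  have hζL := hk.abs_mollify_sub_mollify_le_of_bounded hψs.continuous.measurable hψ1 hkmod
  have hζc : Continuous ζ := (hk.contDiff_mollify hψs.continuous.measurable hψ1).continuous
  have hint : Integrable (fun x => ρ₀ x * ζ x) (cellMeasure d) := by
    refine Integrable.of_bound (C := 1) (hρ₀.measurable.mul hζc.measurable).aestronglyMeasurable
      (Filter.Eventually.of_forall fun x => ?_)
    rw [Real.norm_eq_abs, abs_mul]
    exact mul_le_one₀ (hρ1 x) (abs_nonneg _) (hk.abs_mollify_le hψ1 x)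
  have hint0 : Integrable ρ₀ (cellMeasure d) :=
    Integrable.of_bound (C := 1) hρ₀.measurable.aestronglyMeasurable
      (Filter.Eventually.of_forall hρ1)
  have h2 : ∫ x, ρ₀ x * ζ x ∂(cellMeasure d) = ∫ x, ρ₀ x * (ζ x - ζ 0) ∂(cellMeasure d) := by
    simp_rw [mul_sub]
    rw [integral_sub hint (hint0.mul_const _), integral_mul_const, hρ₀.mean_zero, zero_mul, sub_zero]
  have h3 : ‖∫ x, ρ₀ x * (ζ x - ζ 0) ∂(cellMeasure d)‖ ≤ 1 / 2 := by
    have hae : ∀ᵐ x ∂(cellMeasure d), ‖ρ₀ x * (ζ x - ζ 0)‖ ≤ 1 / 2 := by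
      filter_upwards [ae_restrict_mem measurableSet_cell] with x hx
      rw [norm_mul]
      calc ‖ρ₀ x‖ * ‖ζ x - ζ 0‖ ≤ 1 * (1 / 2) := by
            refine mul_le_mul (hρ1 x) ((hζL x 0).trans ?_) (norm_nonneg _) zero_le_one
            have h4 := norm_le_of_mem_cell hx
            rw [sub_zero, one_mul]
            calc _ ≤ C / (2 * C * (d + 1)) * (d + 1) := by gcongr; linarith
              _ = 1 / 2 := by field_simp
        _ = _ := one_mul _
    simpa using norm_integral_le_of_norm_le_const hae
  rw [← h2, Real.norm_eq_abs] at h3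
  linarith [le_abs_self (∫ x, ρ₀ x * ζ x ∂(cellMeasure d))]

end Mixing

end

/-! ### Conclusion -/

theorem theorem2 (d : ℕ) (p : ℝ≥0∞) (hp : 1 < p) :
    ∃ c C : ℝ, 0 < c ∧ 0 < C ∧
      ∀ (T : ℝ), 0 < T →
      ∀ (u : ℝ → Mixing.E d → Mixing.E d) (ρ₀ : Mixing.E d → ℝ) (ρ : ℝ → Mixing.E d → ℝ),
        Mixing.IsIncompressibleFlow T u →
        Mixing.IsCriticalMixture ρ₀ →
        Mixing.IsTransportSolution T u ρ₀ ρ →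
        ENNReal.ofReal
            (C * Real.exp (-c * ∫ t in (0 : ℝ)..T, (Mixing.gradNorm p (u t)).toReal)) ≤
          Mixing.bvSeminorm ρ₀ * Mixing.hMinusOneNorm (ρ T) := by
  open Mixing in
  obtain ⟨c, hc, hmain⟩ := exists_hMinusOneNorm_ge d hp
  obtain ⟨Ck, hCk, hker⟩ := exists_isKernel d
  -- The factor exp (-c) comes from the I + 1 in `hmain`; 32 * Ck is 4 * L / B for L = 8 * Ck * B,
  -- the Lipschitz constant used below.
  refine ⟨c, Real.exp (-c) / (32 * Ck), hc, by positivity, fun T hT u ρ₀ ρ hflow hρ₀ hρ => ?_⟩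
  set I := ∫ t in (0 : ℝ)..T, (gradNorm p (u t)).toReal with hI
  have hρ1 : ∀ x, |ρ₀ x| ≤ 1 := fun x => by rcases hρ₀.values x with h | h <;> simp [h]
  have hsq : ∫ x, ρ₀ x * ρ₀ x ∂(cellMeasure d) = 1 := by
    have : ∀ x, ρ₀ x * ρ₀ x = 1 := fun x => by rcases hρ₀.values x with h | h <;> simp [h]
    simp [this]
  obtain ⟨ψ, hψs, hψp, hψ1, hψ⟩ := exists_smooth_approx hρ₀.measurable hρ₀.periodic hρ1
    (ε := 1 / 8) (by norm_num)
  rw [hsq] at hψ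
  -- As ∞ * 0 = 0, infinite variation still requires a nonzero negative norm; ψ with its own
  -- Lipschitz bound provides it.
  by_cases hfin : bvSeminorm ρ₀ = ∞
  · obtain ⟨D, hD0, hD⟩ := hψp.fderiv.exists_norm_le (hψs.continuous_fderiv (by simp))
    have hL : ∀ x y, |ψ x - ψ y| ≤ (D + 1) * ‖x - y‖ := fun x y =>
      convex_univ.norm_image_sub_le_of_norm_fderiv_le
        (fun z _ => (hψs.differentiable (by simp)) z)
        (fun z _ => (hD z).trans (by linarith)) (mem_univ y) (mem_univ x)
    have h1 := hmain T hT u ρ₀ ρ hflow hρ₀ hρ ψ (D + 1) (by positivity) hψp hψ1 hL (by linarith)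
    have h2 : hMinusOneNorm (ρ T) ≠ 0 := by
      refine ne_of_gt (lt_of_lt_of_le ?_ h1)
      rw [ENNReal.ofReal_pos]
      positivity
    rw [hfin, ENNReal.top_mul h2]
    exact le_top
  · set B := (bvSeminorm ρ₀).toReal with hB
    have hB0 : 0 < B := ENNReal.toReal_pos hρ₀.bvSeminorm_ne_zero hfin
    -- Mollifying at this scale costs 1 / 8 of correlation, which together with the 1 / 8 lost in
    -- approximating ρ₀ leaves 3 / 4.
    obtain ⟨k, hk, hkmod⟩ := hker (1 / (8 * B)) (by positivity)
    have hcorr := hk.integral_mul_sub_le_mollify hρ₀.measurable hρ1 hfin hψs hψp hψ1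
    have hrB : 1 / (8 * B) * B = 1 / 8 := by field_simp
    rw [← hB, hrB] at hcorr
    have hL := hk.abs_mollify_sub_mollify_le_of_bounded hψs.continuous.measurable hψ1 hkmod
    rw [one_mul] at hL
    have h1 := hmain T hT u ρ₀ ρ hflow hρ₀ hρ (mollify k ψ) (Ck / (1 / (8 * B))) (by positivity)
      (hψp.mollify k) (hk.abs_mollify_le hψ1) hL (by linarith)
    rw [← ENNReal.ofReal_toReal hfin, ← hB]
    calc _ = ENNReal.ofReal B * ENNReal.ofReal (1 / (4 * (Ck / (1 / (8 * B)))) *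
          Real.exp (-c * (I + 1))) := by
          rw [← ENNReal.ofReal_mul hB0.le, mul_add, Real.exp_add, mul_one]
          congr 1
          field_simp
          norm_num
      _ ≤ _ := by gcongr
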